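/- Let $q^{1/2}$ be a formal variable. Let $\mathcal T$ be the quantum torus over $\mathbb Z[q^{\pm 1/2}]$ generated by $X_1^{\pm1},X_2^{\pm1}$ with $X_1X_2=qX_2X_1$, and let $\mathcal F$ be its skew field of fractions. For $(a,b)\in\mathbb Z^2$ put $X^{(a,b)}=q^{-ab/2}X_1^aX_2^b$; these elements form a $\mathbb Z[q^{\pm1/2}]$-basis of $\mathcal T$. The bar-involution is the $\mathbb Z$-linear map on $\mathcal T$ with $\overline{q^{r/2}X^{(a,b)}}=q^{-r/2}X^{(a,b)}$ for $r,a,b\in\mathbb Z$. Define the cluster variables $X_k\in\mathcal F$, $k\in\mathbb Z$, recursively from $X_1,X_2$ by $$X_{k-1}X_{k+1}=\begin{cases}q^{1/2}X_k+1,& k\text{ odd},\\ q^2X_k^4+1,& k\text{ even},\end{cases}$$ and let $\mathcal A_q(1,4)$ be the $\mathbb Z[q^{\pm1/2}]$-subalgebra of $\mathcal F$ generated by all $X_k$. Put $$X_\delta=X^{(-1,-2)}+X^{(-1,2)}+X^{(1,-2)}+(q^{-1/2}+q^{1/2})X^{(0,-2)}.$$ Define $F_n,S_n\in\mathbb Z[x]$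 for $n\ge 0$ by $F_0=S_0=1$, $F_1=S_1=x$, $F_2=x^2-2$, $S_2=x^2-1$, and $F_{n+1}=F_nx-F_{n-1}$, $S_{n+1}=S_nx-S_{n-1}$ for $n\ge2$. Let $\mathcal M=\{q^{-ab/2}X_m^aX_{m+1}^b : m\in\mathbb Z,\ a,b\in\mathbb Z_{\ge0}\}$ be the set of cluster monomials, and let $$\mathcal B=\mathcal M\cup\{F_n(X_\delta):n\ge0\},\qquad \mathcal S=\mathcal M\cup\{S_n(X_\delta):n\ge0\},\qquad \mathcal D=\mathcal M\cup\{X_\delta^n:n\ge0\}.$$ Then each of the sets $\mathcal B$, $\mathcal S$ and $\mathcal D$ is a bar-invariant $\mathbb Z[q^{\pm1/2}]$-basis of $\mathcal A_q(1,4)$: each of its elements lies in $\mathcal T$ and is fixed by the bar-involution, it is linearly independent over $\mathbb Z[q^{\pm1/2}]$, and its $\mathbb Z[q^{\pm1/2}]$-span is $\mathcal A_q(1,4)$. -/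

import Mathlib

noncomputable section

namespace QCluster

/-! ### The quantum torus -/

/-- The ring `ℤ[q^{±1/2}]`, as Laurent polynomials over `ℤ` in the variable `q^{1/2}`. -/
abbrev Coeff : Type := LaurentPolynomial ℤ

/-- The power `q^{r/2}`, for an integer `r`. -/
def qh (r : ℤ) : Coeff := LaurentPolynomial.T r

/-- The quantum torus `ℤ[q^{±1/2}]⟨X₁^{±1}, X₂^{±1} | X₁X₂ = qX₂X₁⟩`, as the free
`ℤ[q^{±1/2}]`-module on the normalised monomials `X^{(a,b)} = q^{-ab/2} X₁^a X₂^b`, `(a,b) ∈ ℤ²`: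
an element is given by its finitely supported family of coefficients. -/
@[ext]
structure QTorus : Type where
  /-- The coefficients with respect to the normalised monomials. -/
  coeff : (ℤ × ℤ) →₀ Coeff

namespace QTorus

/-- An element of the quantum torus is its family of coefficients. -/
def equiv : QTorus ≃ ((ℤ × ℤ) →₀ Coeff) := ⟨coeff, mk, fun _ => rfl, fun _ => rfl⟩

instance : AddCommGroup QTorus := equiv.addCommGroup

instance : Module Coeff QTorus := equiv.module Coeff

instance : Nontrivial QTorus := equiv.nontrivial

theorem coeff_zero : (0 : QTorus).coeff = 0 := rfl

theorem coeff_add (x y : QTorus) : (x + y).coeff = x.coeff + y.coeff := rfl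

theorem coeff_smul (r : Coeff) (x : QTorus) : (r • x).coeff = r • x.coeff := rfl

/-- The element `c X^v`. -/
def term (v : ℤ × ℤ) (c : Coeff) : QTorus := ⟨Finsupp.single v c⟩

theorem coeff_term (v : ℤ × ℤ) (c : Coeff) : (term v c).coeff = Finsupp.single v c := rfl

/-- The normalised monomial `X^{(a,b)} = q^{-ab/2} X₁^a X₂^b`. -/
def mono (a b : ℤ) : QTorus := term (a, b) 1

/-- The exponent in `X^v X^w = q^{tw v w / 2} X^{v+w}`. -/
def tw (v w : ℤ × ℤ) : ℤ := -(v.2 * w.1 - v.1 * w.2)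

/-- The bilinear multiplication with `X^{(a,b)} X^{(c,d)} = q^{-(bc-ad)/2} X^{(a+c,b+d)}`. -/
instance : Mul QTorus :=
  ⟨fun x y => x.coeff.sum fun v c => y.coeff.sum fun w d => term (v + w) (c * d * qh (tw v w))⟩

instance : One QTorus := ⟨mono 0 0⟩

theorem mul_def (x y : QTorus) : x * y =
    x.coeff.sum fun v c => y.coeff.sum fun w d => term (v + w) (c * d * qh (tw v w)) := rfl

theorem one_def : (1 : QTorus) = term 0 1 := rfl

theorem term_zero (v : ℤ × ℤ) : term v 0 = 0 := QTorus.ext (Finsupp.single_zero v)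

theorem term_add (v : ℤ × ℤ) (c d : Coeff) : term v (c + d) = term v c + term v d :=
  QTorus.ext (Finsupp.single_add v c d)

theorem smul_term (r : Coeff) (v : ℤ × ℤ) (c : Coeff) : r • term v c = term v (r * c) :=
  QTorus.ext (Finsupp.smul_single r v c)

@[elab_as_elim]
theorem induction_on {p : QTorus → Prop} (x : QTorus) (h0 : p 0)
    (hadd : ∀ x y, p x → p y → p (x + y)) (hterm : ∀ v c, p (term v c)) : p x := by
  obtain ⟨f⟩ := x
  exact Finsupp.induction_linear (motive := fun f => p ⟨f⟩) f h0
    (fun f g hf hg => hadd ⟨f⟩ ⟨g⟩ hf hg) hterm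

theorem qh_zero : qh 0 = 1 := LaurentPolynomial.T_zero

theorem qh_add (r s : ℤ) : qh (r + s) = qh r * qh s := LaurentPolynomial.T_add r s

theorem qh_ne_zero (r : ℤ) : qh r ≠ 0 := (LaurentPolynomial.isUnit_T r).ne_zero

theorem term_mul_term (v w : ℤ × ℤ) (c d : Coeff) :
    term v c * term w d = term (v + w) (c * d * qh (tw v w)) := by
  rw [mul_def, coeff_term, coeff_term, Finsupp.sum_single_index, Finsupp.sum_single_index]
  · simp [term_zero]
  · simp [term_zero]

protected theorem add_mul (x y z : QTorus) : (x + y) * z = x * z + y * z := by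
  rw [mul_def, mul_def, mul_def, coeff_add]
  refine Finsupp.sum_add_index' (fun v => ?_) (fun v c d => ?_)
  · simp [term_zero]
  · rw [← Finsupp.sum_add]
    simp only [add_mul, term_add]

protected theorem mul_add (x y z : QTorus) : x * (y + z) = x * y + x * z := by
  rw [mul_def, mul_def, mul_def, coeff_add, ← Finsupp.sum_add]
  congr 1
  funext v c
  refine Finsupp.sum_add_index' (fun w => ?_) (fun w d e => ?_)
  · simp [term_zero]
  · simp only [mul_add, add_mul, term_add]

protected theorem zero_mul (x : QTorus) : 0 * x = 0 := by
  simpa using QTorus.add_mul 0 0 x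

protected theorem mul_zero (x : QTorus) : x * 0 = 0 := by
  simpa using QTorus.mul_add x 0 0

protected theorem mul_assoc (x y z : QTorus) : x * y * z = x * (y * z) := by
  induction x using induction_on with
  | h0 => simp only [QTorus.zero_mul]
  | hadd a b ha hb => simp only [QTorus.add_mul, ha, hb]
  | hterm u a =>
  induction y using induction_on with
  | h0 => simp only [QTorus.zero_mul, QTorus.mul_zero]
  | hadd a b ha hb => simp only [QTorus.add_mul, QTorus.mul_add, ha, hb]
  | hterm v b =>
  induction z using induction_on with
  | h0 => simp only [QTorus.mul_zero]
  | hadd a b ha hb => simp only [QTorus.mul_add, ha, hb]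
  | hterm w c =>
  simp only [term_mul_term, add_assoc]
  congr 1
  have : tw u v + tw (u + v) w = tw v w + tw u (v + w) := by
    simp only [tw, Prod.fst_add, Prod.snd_add]; ring
  calc a * b * qh (tw u v) * c * qh (tw (u + v) w)
      = a * b * c * qh (tw u v + tw (u + v) w) := by rw [qh_add]; ring
    _ = a * (b * c * qh (tw v w)) * qh (tw u (v + w)) := by rw [this, qh_add]; ring

protected theorem one_mul (x : QTorus) : 1 * x = x := by
  induction x using induction_on with
  | h0 => exact QTorus.mul_zero 1
  | hadd a b ha hb => rw [QTorus.mul_add, ha, hb]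
  | hterm u a => rw [one_def, term_mul_term]; simp [tw, qh_zero]

protected theorem mul_one (x : QTorus) : x * 1 = x := by
  induction x using induction_on with
  | h0 => exact QTorus.zero_mul 1
  | hadd a b ha hb => rw [QTorus.add_mul, ha, hb]
  | hterm u a => rw [one_def, term_mul_term]; simp [tw, qh_zero]

instance : Ring QTorus where
  __ := (inferInstance : AddCommGroup QTorus)
  left_distrib := QTorus.mul_add
  right_distrib := QTorus.add_mul
  zero_mul := QTorus.zero_mul
  mul_zero := QTorus.mul_zero
  mul_assoc := QTorus.mul_assoc
  one_mul := QTorus.one_mul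
  mul_one := QTorus.mul_one

protected theorem smul_mul (r : Coeff) (x y : QTorus) : r • x * y = r • (x * y) := by
  induction x using induction_on with
  | h0 => simp only [smul_zero, zero_mul]
  | hadd a b ha hb => simp only [smul_add, add_mul, ha, hb]
  | hterm u a =>
  induction y using induction_on with
  | h0 => simp only [smul_zero, mul_zero]
  | hadd a b ha hb => simp only [smul_add, mul_add, ha, hb]
  | hterm v b => simp only [smul_term, term_mul_term, mul_assoc]

protected theorem mul_smul (r : Coeff) (x y : QTorus) : x * r • y = r • (x * y) := by
  induction x using induction_on with
  | h0 => simp only [smul_zero, zero_mul]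
  | hadd a b ha hb => simp only [smul_add, add_mul, ha, hb]
  | hterm u a =>
  induction y using induction_on with
  | h0 => simp only [smul_zero, mul_zero]
  | hadd a b ha hb => simp only [smul_add, mul_add, ha, hb]
  | hterm v b => simp only [smul_term, term_mul_term, mul_assoc, mul_left_comm]

instance : Algebra Coeff QTorus := Algebra.ofModule QTorus.smul_mul QTorus.mul_smul

theorem mono_mul_mono (a b c d : ℤ) :
    mono a b * mono c d = qh (-(b * c - a * d)) • mono (a + c) (b + d) := by
  rw [mono, mono, mono, term_mul_term, smul_term, one_mul, one_mul, mul_one]; rfl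

/-- The defining relation `X₁X₂ = qX₂X₁`. -/
theorem X_one_mul_X_two : mono 1 0 * mono 0 1 = qh 2 • (mono 0 1 * mono 1 0) := by
  rw [mono_mul_mono, mono_mul_mono, smul_smul, ← qh_add]; norm_num

/-- The bar-involution: the `ℤ`-linear map of the quantum torus with
`q^{r/2} X^{(a,b)} ↦ q^{-r/2} X^{(a,b)}`. -/
def bar : QTorus →+ QTorus where
  toFun x := ⟨x.coeff.mapRange LaurentPolynomial.invert (map_zero LaurentPolynomial.invert)⟩
  map_zero' := QTorus.ext (Finsupp.mapRange_zero (hf := map_zero LaurentPolynomial.invert))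
  map_add' x y := QTorus.ext (Finsupp.mapRange_add (hf := map_zero LaurentPolynomial.invert)
    (map_add LaurentPolynomial.invert) x.coeff y.coeff)

theorem bar_term (v : ℤ × ℤ) (c : Coeff) : bar (term v c) = term v (LaurentPolynomial.invert c) :=
  QTorus.ext (Finsupp.mapRange_single (hf := map_zero LaurentPolynomial.invert))

theorem bar_qh_smul_mono (r a b : ℤ) : bar (qh r • mono a b) = qh (-r) • mono a b := by
  rw [mono, smul_term, smul_term, bar_term, mul_one, mul_one, qh, qh, LaurentPolynomial.invert_T]

/-! ### The skew field of fractions -/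

theorem coeff_mul (x y : QTorus) (p : ℤ × ℤ) : (x * y).coeff p =
    ∑ v ∈ x.coeff.support, ∑ w ∈ y.coeff.support,
      if v + w = p then x.coeff v * y.coeff w * qh (tw v w) else 0 := by
  let φ : QTorus →+ Coeff :=
    { toFun := fun z => z.coeff p, map_zero' := rfl, map_add' := fun _ _ => rfl }
  change φ (x * y) = _
  rw [mul_def, Finsupp.sum, map_sum]
  refine Finset.sum_congr rfl fun v _ => ?_
  rw [Finsupp.sum, map_sum]
  refine Finset.sum_congr rfl fun w _ => ?_
  exact Finsupp.single_apply

instance : NoZeroDivisors QTorus where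
  eq_zero_or_eq_zero_of_mul_eq_zero := by
    intro x y hxy
    by_contra! h
    have hx : x.coeff.support.Nonempty :=
      Finsupp.support_nonempty_iff.mpr fun h0 => h.1 (QTorus.ext h0)
    have hy : y.coeff.support.Nonempty :=
      Finsupp.support_nonempty_iff.mpr fun h0 => h.2 (QTorus.ext h0)
    obtain ⟨v, hv, w, hw, huniq⟩ := UniqueSums.uniqueAdd_of_nonempty hx hy
    have key : (x * y).coeff (v + w) = x.coeff v * y.coeff w * qh (tw v w) := by
      rw [coeff_mul, Finset.sum_eq_single_of_mem v hv, Finset.sum_eq_single_of_mem w hw, if_pos rfl]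
      · intro w' hw' hne
        exact if_neg fun he => hne (huniq hv hw' he).2
      · intro v' hv' hne
        exact Finset.sum_eq_zero fun w' hw' => if_neg fun he => hne (huniq hv' hw' he).1
    rw [hxy] at key
    exact mul_ne_zero (mul_ne_zero (Finsupp.mem_support_iff.mp hv) (Finsupp.mem_support_iff.mp hw))
      (qh_ne_zero _) key.symm

/-- The square `[-n, n]²`. -/
def box (n : ℕ) : Finset (ℤ × ℤ) := Finset.Icc (-(n : ℤ)) n ×ˢ Finset.Icc (-(n : ℤ)) n

theorem card_box (n : ℕ) : (box n).card = (2 * n + 1) ^ 2 := by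
  rw [box, Finset.card_product, Int.card_Icc, sq]
  congr 1 <;> omega

theorem exists_support_subset_box (x : QTorus) : ∃ n : ℕ, ∀ m, n ≤ m → x.coeff.support ⊆ box m := by
  refine ⟨∑ v ∈ x.coeff.support, (v.1.natAbs + v.2.natAbs), fun m hm v hv => ?_⟩
  have := Finset.single_le_sum (f := fun v : ℤ × ℤ => v.1.natAbs + v.2.natAbs)
    (fun _ _ => Nat.zero_le _) hv
  simp only [box, Finset.mem_product, Finset.mem_Icc]
  omega

theorem support_mul_subset_box {x y : QTorus} {m n : ℕ} (hx : x.coeff.support ⊆ box m)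
    (hy : y.coeff.support ⊆ box n) {p : ℤ × ℤ} (hp : p ∉ box (m + n)) : (x * y).coeff p = 0 := by
  rw [coeff_mul]
  refine Finset.sum_eq_zero fun v hv => Finset.sum_eq_zero fun w hw => if_neg ?_
  rintro rfl
  have h1 := hx hv
  have h2 := hy hw
  simp only [box, Finset.mem_product, Finset.mem_Icc, Prod.fst_add, Prod.snd_add] at h1 h2 hp
  push_cast at hp
  omega

/-- The element with prescribed coefficients on a finite set. -/
def ofBox (s : Finset (ℤ × ℤ)) : (s → Coeff) →ₗ[Coeff] QTorus where
  toFun f := ∑ v : s, term v (f v)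
  map_add' f g := by simp only [Pi.add_apply, term_add, Finset.sum_add_distrib]
  map_smul' r f := by
    simp only [Pi.smul_apply, smul_eq_mul, ← smul_term, Finset.smul_sum, RingHom.id_apply]

theorem coeff_ofBox (s : Finset (ℤ × ℤ)) (f : s → Coeff) (p : ℤ × ℤ) :
    (ofBox s f).coeff p = if h : p ∈ s then f ⟨p, h⟩ else 0 := by
  let φ : QTorus →+ Coeff :=
    { toFun := fun z => z.coeff p, map_zero' := rfl, map_add' := fun _ _ => rfl }
  change φ (∑ v : s, term v (f v)) = _
  rw [map_sum]
  have h1 : ∀ v : s, φ (term v (f v)) = if (v : ℤ × ℤ) = p then f v else 0 :=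
    fun v => Finsupp.single_apply
  simp only [h1]
  split_ifs with h
  · rw [Finset.sum_eq_single_of_mem ⟨p, h⟩ (Finset.mem_univ _), if_pos rfl]
    exact fun v _ hne => if_neg fun he => hne (Subtype.ext he)
  · exact Finset.sum_eq_zero fun v _ => if_neg fun (he : (v : ℤ × ℤ) = p) => h (he ▸ v.2)

theorem support_ofBox (s : Finset (ℤ × ℤ)) (f : s → Coeff) : (ofBox s f).coeff.support ⊆ s := by
  intro p hp
  by_contra h
  exact Finsupp.mem_support_iff.mp hp (by rw [coeff_ofBox, dif_neg h])

theorem ofBox_injective (s : Finset (ℤ × ℤ)) : Function.Injective (ofBox s) := by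
  intro f g h
  funext v
  have := congrArg (fun z => z.coeff v) h
  simpa only [coeff_ofBox, v.2, dite_true] using this

/-- The Ore condition, by counting dimensions: for large `m` there are more pairs of elements
supported in `[-m, m]²` than the products with two given elements can distinguish. -/
theorem ore (x s : QTorus) (hs : s ≠ 0) : ∃ y t : QTorus, t ≠ 0 ∧ t * x = y * s := by
  obtain ⟨n₁, h₁⟩ := exists_support_subset_box x
  obtain ⟨n₂, h₂⟩ := exists_support_subset_box s
  obtain ⟨n, hx, hs'⟩ : ∃ n, x.coeff.support ⊆ box n ∧ s.coeff.support ⊆ box n :=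
    ⟨max n₁ n₂, h₁ _ (le_max_left _ _), h₂ _ (le_max_right _ _)⟩
  let B := box (3 * n)
  let C := box (3 * n + n)
  let g : (B ⊕ B → Coeff) →ₗ[Coeff] QTorus :=
    LinearMap.mulRight Coeff x ∘ₗ ofBox B ∘ₗ LinearMap.funLeft Coeff Coeff Sum.inl
      - LinearMap.mulRight Coeff s ∘ₗ ofBox B ∘ₗ LinearMap.funLeft Coeff Coeff Sum.inr
  have hg : ∀ f, g f = ofBox B (f ∘ Sum.inl) * x - ofBox B (f ∘ Sum.inr) * s := fun f => rfl
  let r : (B ⊕ B → Coeff) →ₗ[Coeff] (C → Coeff) :=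
    { toFun := fun f p => (g f).coeff p
      map_add' := fun f f' => by rw [map_add]; rfl
      map_smul' := fun a f => by rw [map_smul]; rfl }
  have hr : ¬ Function.Injective r := by
    intro hi
    have := card_le_of_injective Coeff r hi
    simp only [Fintype.card_sum, Fintype.card_coe, B, C, card_box] at this
    ring_nf at this
    omega
  rw [← LinearMap.ker_eq_bot, ← ne_eq, Submodule.ne_bot_iff] at hr
  obtain ⟨f, hf, hf0⟩ := hr
  have hgf : g f = 0 := by
    ext1
    ext1 p
    by_cases hp : p ∈ C
    · exact congrFun hf ⟨p, hp⟩
    · rw [hg, sub_eq_add_neg, ← neg_mul, ← map_neg, coeff_add, Finsupp.add_apply,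
        support_mul_subset_box (support_ofBox _ _) hx hp,
        support_mul_subset_box (support_ofBox _ _) hs' hp]
      exact add_zero 0
  rw [hg, sub_eq_zero] at hgf
  refine ⟨_, _, fun h0 => hf0 ?_, hgf⟩
  rw [h0, zero_mul] at hgf
  have h0' := (mul_eq_zero.mp hgf.symm).resolve_right hs
  have e1 := ofBox_injective B (h0.trans (map_zero (ofBox B)).symm)
  have e2 := ofBox_injective B (h0'.trans (map_zero (ofBox B)).symm)
  funext i
  rcases i with i | i
  · exact congrFun e1 i
  · exact congrFun e2 i

instance : OreLocalization.OreSet (nonZeroDivisors QTorus) :=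
  Classical.choice <| OreLocalization.nonempty_oreSet_iff_of_noZeroDivisors.mpr fun x s => by
    obtain ⟨y, t, ht, h⟩ := ore x s (nonZeroDivisors.coe_ne_zero s)
    exact ⟨y, ⟨t, mem_nonZeroDivisors_of_ne_zero ht⟩, h⟩

end QTorus

/-- The skew field of fractions of the quantum torus. -/
abbrev SkewFrac : Type := OreLocalization (nonZeroDivisors QTorus) QTorus

/-- The inclusion of the quantum torus in its skew field of fractions. -/
def incl : QTorus →+* SkewFrac := OreLocalization.numeratorRingHom

/-! ### The quantum cluster algebra -/

/-- The right-hand side of the exchange relation for `X_{k-1} X_{k+1}`, at `x = X_k`. -/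
def exch (k : ℤ) (x : SkewFrac) : SkewFrac :=
  if Odd k then qh 1 • x + 1 else qh 4 • x ^ 4 + 1

/-- The pairs `(X_{n+1}, X_{n+2})`, where `X_{k+1} = X_{k-1}⁻¹ (X_{k-1} X_{k+1})`. -/
def forward : ℕ → SkewFrac × SkewFrac
  | 0 => (incl (QTorus.mono 1 0), incl (QTorus.mono 0 1))
  | n + 1 => ((forward n).2, (forward n).1⁻¹ * exch (n + 2) (forward n).2)

/-- The pairs `(X_{1-n}, X_{2-n})`, where `X_{k-1} = (X_{k-1} X_{k+1}) X_{k+1}⁻¹`. -/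
def backward : ℕ → SkewFrac × SkewFrac
  | 0 => (incl (QTorus.mono 1 0), incl (QTorus.mono 0 1))
  | n + 1 => (exch (1 - n) (backward n).1 * (backward n).2⁻¹, (backward n).1)

/-- The cluster variables `X_k`, `k ∈ ℤ`: the initial ones are `X₁`, `X₂`, and
`X_{k-1} X_{k+1}` is `q^{1/2} X_k + 1` for odd `k` and `q² X_k⁴ + 1` for even `k`. -/
def clusterVar : ℤ → SkewFrac
  | Int.ofNat 0 => (backward 1).1
  | Int.ofNat (n + 1) => (forward n).1
  | Int.negSucc n => (backward (n + 2)).1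

/-- The quantum cluster algebra `A_q(1,4)`. -/
def clusterAlg : Subalgebra Coeff SkewFrac := Algebra.adjoin Coeff (Set.range clusterVar)

/-- The element `X_δ`. -/
def Xdelta : SkewFrac :=
  incl (QTorus.mono (-1) (-2) + QTorus.mono (-1) 2 + QTorus.mono 1 (-2)
    + (qh (-1) + qh 1) • QTorus.mono 0 (-2))

/-- The cluster monomials `q^{-ab/2} X_m^a X_{m+1}^b`. -/
def clusterMonomials : Set SkewFrac :=
  {x | ∃ (m : ℤ) (a b : ℕ), x = qh (-(a * b)) • (clusterVar m ^ a * clusterVar (m + 1) ^ b)}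

/-- The Chebyshev polynomials of the first kind: `F₀ = 1`, `F₁ = x`, `F₂ = x² - 2` and
`F_{n+1} = F_n x - F_{n-1}` for `n ≥ 2`. -/
def chebF : ℕ → Polynomial ℤ
  | 0 => 1
  | 1 => Polynomial.X
  | 2 => Polynomial.X ^ 2 - 2
  | n + 3 => chebF (n + 2) * Polynomial.X - chebF (n + 1)

/-- The Chebyshev polynomials of the second kind: `S₀ = 1`, `S₁ = x`, `S₂ = x² - 1` and
`S_{n+1} = S_n x - S_{n-1}` for `n ≥ 2`. -/
def chebS : ℕ → Polynomial ℤ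
  | 0 => 1
  | 1 => Polynomial.X
  | 2 => Polynomial.X ^ 2 - 1
  | n + 3 => chebS (n + 2) * Polynomial.X - chebS (n + 1)

/-- The set `𝓑`. -/
def setB : Set SkewFrac :=
  clusterMonomials ∪ {x | ∃ n : ℕ, x = Polynomial.aeval Xdelta (chebF n)}

/-- The set `𝓢`. -/
def setS : Set SkewFrac :=
  clusterMonomials ∪ {x | ∃ n : ℕ, x = Polynomial.aeval Xdelta (chebS n)}

/-- The set `𝓓`. -/
def setD : Set SkewFrac := clusterMonomials ∪ {x | ∃ n : ℕ, x = Xdelta ^ n}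

/-- A set of elements of the skew field of fractions is a bar-invariant `ℤ[q^{±1/2}]`-basis of
`A_q(1,4)` if each of its elements lies in the quantum torus and is fixed by the bar-involution,
if it is linearly independent over `ℤ[q^{±1/2}]`, and if its span is `A_q(1,4)`. -/
def IsBarInvariantBasis (C : Set SkewFrac) : Prop :=
  (∀ x ∈ C, ∃ t : QTorus, incl t = x ∧ QTorus.bar t = t) ∧
    LinearIndepOn Coeff id C ∧
    Submodule.span Coeff C = Subalgebra.toSubmodule clusterAlg

end QCluster

end

/-!
Everything takes place in the quantum torus `T`, in which an element is called *pointed* at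
`v ∈ ℤ²` if `X^v` occurs in it with an invertible coefficient and `v` is the componentwise least
exponent that occurs (`Pointed`). Pointedness is multiplicative, and a family `(E_w)`, `w ∈ ℤ²`,
with `E_w` pointed at `w` is linearly independent (`linearIndependent_of_pointed`), because a
minimal index in a linear relation contributes an exponent that nothing else can cancel.

*Cluster variables.* Three consecutive even cluster variables `x, y, w` satisfy
`y X_δ = q^{1/2} w + q^{-1/2} x`, `x w = q y² + q^{-1/2} X_δ`, a `q`-commutation rule for `x y`, and
the bar-conjugates of these relations. Such relations propagate to the next triple
(`ExchangeTriple.step`) in both directions, since they are symmetric under reversing the triple and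
exchanging `q` with `q⁻¹`. Hence the even variables are given by a linear recursion whose
coefficient is `X_δ`, the odd ones by `q^{-1/2} (X_{2m} X_{2m+2} - 1)`, and the exchange relations
follow (`ExchangeTriple.exchange`). This yields the Laurent phenomenon, bar-invariance, and the
least exponents (`pointed_torusVar`).

*Linear independence.* The least exponents of the cluster variables are the rays of a fan that
covers `ℤ²` except for the ray of `X_δ` (`exists_leadMono`, `leadMono_injective`). For monic
polynomials `p_n` of degree `n`, the element `p_n(X_δ)` is pointed at `(-n, -2n)` on that ray. So
the cluster monomials and the `p_n(X_δ)` form a family pointed at each `w ∈ ℤ²` exactly once.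

*Spanning.* The algebra is spanned by the monomials in `X₀, X₁, X₂, X₃` that contain neither
`X₀ X₂` nor `X₁ X₃` (`toSubmodule_torusClusterAlg`), and these form a pointed family as well. Up to
powers of `q^{1/2}`, such a monomial is a cluster monomial unless both coordinates of `w` are
negative; in that quadrant the two families are related by a matrix that is unitriangular up to
units for a well-founded order (`mem_span_of_pointed`). So both families have the same span.

The polynomials `F_n`, `S_n` and `x^n` are monic of degree `n`, so all three sets are covered by
`isBarInvariantBasis_of_monic`.
-/

noncomputable section

namespace QCluster

/-! ### Exchange triples -/

/-- The relations between three cluster variables `x = X_{2m-2}`, `y = X_{2m}`, `w = X_{2m+2}` and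
`Z = X_δ`, over a ring of scalars where `h` stands for `q^{1/2}` and `h'` for `q^{-1/2}`. They are
symmetric under exchanging `h` with `h'` and `x` with `w`. -/
structure ExchangeTriple {K R : Type*} [CommRing K] [Ring R] [Algebra K R] (h h' : K)
    (Z x y w : R) : Prop where
  mul_Z : y * Z = h • w + h' • x
  Z_mul : Z * y = h' • w + h • x
  comm : x * y = h ^ 2 • (y * x) + (1 - h ^ 2) • 1
  mul_skip : x * w = h ^ 2 • y ^ 2 + h' • Z
  skip_mul : w * x = h' ^ 2 • y ^ 2 + h • Z

namespace ExchangeTriple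

variable {K R : Type*} [CommRing K] [Ring R] [Algebra K R] {h h' : K} {Z x y w : R}

theorem right_eq (hh : h * h' = 1) (H : ExchangeTriple h h' Z x y w) :
    w = h' • (y * Z) - h' ^ 2 • x := by
  rw [H.mul_Z]; match_scalars <;> grind

theorem right_eq' (hh : h * h' = 1) (H : ExchangeTriple h h' Z x y w) :
    w = h • (Z * y) - h ^ 2 • x := by
  rw [H.Z_mul]; match_scalars <;> grind

theorem comm_right (hh : h * h' = 1) (H : ExchangeTriple h h' Z x y w) :
    y * w = h ^ 2 • (w * y) + (1 - h ^ 2) • 1 := by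
  have e1 : y * w = h • (y * Z * y) - h ^ 2 • (y * x) := by
    conv_lhs => rw [H.right_eq' hh]
    simp only [mul_sub, mul_smul_comm, mul_assoc]
  have e2 : w * y = h' • (y * Z * y) - h' ^ 2 • (x * y) := by
    conv_lhs => rw [H.right_eq hh]
    simp only [sub_mul, smul_mul_assoc, mul_assoc]
  rw [e1, e2, H.comm]
  match_scalars <;> grind

theorem swap (hh : h * h' = 1) (H : ExchangeTriple h h' Z x y w) :
    ExchangeTriple h' h Z w y x where
  mul_Z := by rw [H.mul_Z, add_comm]
  Z_mul := by rw [H.Z_mul, add_comm]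
  comm := by rw [H.comm_right hh]; match_scalars <;> grind
  mul_skip := H.skip_mul
  skip_mul := H.mul_skip

/-- The recursion `X_{2m+4} = q^{-1/2} X_{2m+2} X_δ - q^{-1} X_{2m}` propagates the relations. -/
theorem step (hh : h * h' = 1) (H : ExchangeTriple h h' Z x y w) :
    ExchangeTriple h h' Z y w (h' • (w * Z) - h' ^ 2 • y) := by
  have hc := H.comm_right hh
  have hZw : Z * w = h' ^ 2 • (w * Z) + (h - h' ^ 3) • y := by
    have hZ : Z = h • (x * w) - (h ^ 3) • y ^ 2 := by
      rw [H.mul_skip]; match_scalars <;> grind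
    have hZ' : Z = h' • (w * x) - (h' ^ 3) • y ^ 2 := by
      rw [H.skip_mul]; match_scalars <;> grind
    have e1 : w * Z = h • (w * x * w) - h ^ 3 • (w * y * y) := by
      conv_lhs => rw [hZ]
      simp only [mul_sub, mul_smul_comm, mul_assoc, sq]
    have e2 : Z * w = h' • (w * x * w) - h' ^ 3 • (y * (y * w)) := by
      conv_lhs => rw [hZ']
      simp only [sub_mul, smul_mul_assoc, mul_assoc, sq]
    rw [e1, e2, hc, mul_add, mul_smul_comm, mul_smul_comm, mul_one, ← mul_assoc, hc, add_mul,
      smul_mul_assoc, smul_mul_assoc, one_mul]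
    match_scalars <;> grind
  have hZy := H.mul_Z
  have hyZ := H.Z_mul
  refine ⟨?_, ?_, hc, ?_, ?_⟩
  · match_scalars <;> grind
  · rw [hZw]; match_scalars <;> grind
  · have e : y * (w * Z) = h ^ 2 • (w * (h • w + h' • x)) + (1 - h ^ 2) • Z := by
      rw [← hZy, ← mul_assoc, hc, add_mul, smul_mul_assoc, smul_mul_assoc, one_mul, mul_assoc]
    rw [mul_sub, mul_smul_comm, mul_smul_comm, e, mul_add, mul_smul_comm, mul_smul_comm,
      H.skip_mul, ← sq, ← sq]
    match_scalars <;> grind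
  · have e : w * Z = h ^ 2 • (Z * w) - (h ^ 3 - h') • y := by
      rw [hZw]; match_scalars <;> grind
    have e' : Z * (w * y) = h' ^ 2 • ((h' • w + h • x) * w) + (1 - h' ^ 2) • Z := by
      have : w * y = h' ^ 2 • (y * w) + (1 - h' ^ 2) • 1 := by
        rw [hc]; match_scalars <;> grind
      rw [← hyZ, this, mul_add, mul_smul_comm, mul_smul_comm, mul_one, mul_assoc]
    rw [e, sub_mul, smul_mul_assoc, sub_mul, smul_mul_assoc, smul_mul_assoc,
      smul_mul_assoc, mul_assoc Z, e', add_mul, smul_mul_assoc, smul_mul_assoc,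
      H.mul_skip, ← sq, ← sq]
    match_scalars <;> grind

/-- The product `X_{2m-1} X_{2m+1} = q² X_{2m}⁴ + 1`, for the odd cluster variables
`q^{-1/2}(X_{2m-2} X_{2m} - 1)` and `q^{-1/2}(X_{2m} X_{2m+2} - 1)`. -/
theorem exchange (hh : h * h' = 1) (H : ExchangeTriple h h' Z x y w) :
    (h' • (x * y - 1)) * (h' • (y * w - 1)) = h ^ 4 • y ^ 4 + 1 := by
  have hc := H.comm_right hh
  have e1 : y * (x * w) * y = h ^ 2 • y ^ 4 + h' • (y * Z * y) := by
    rw [H.mul_skip, mul_add, add_mul]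
    simp only [mul_smul_comm, smul_mul_assoc]
    congr 2
    noncomm_ring
  have e2 : y * Z * y = h • (w * y) + h' • (h ^ 2 • (y * x) + (1 - h ^ 2) • 1) := by
    rw [H.mul_Z, add_mul, smul_mul_assoc, smul_mul_assoc, H.comm]
  have e3 : (y * x) * (w * y) = h ^ 2 • y ^ 4 + h' • (y * Z * y) := by
    rw [← e1]; noncomm_ring
  rw [H.comm, hc]
  simp only [mul_sub, sub_mul, mul_add, add_mul, smul_mul_assoc, mul_smul_comm, mul_one, one_mul]
  rw [e3, e2]
  match_scalars <;> grind

end ExchangeTriple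

/-- The sequence with the initial terms `a`, `b` and the recursion of `ExchangeTriple.step`. -/
def linSeq {K R : Type*} [CommRing K] [Ring R] [Algebra K R] (h' : K) (Z a b : R) : ℕ → R
  | 0 => a
  | 1 => b
  | n + 2 => h' • (linSeq h' Z a b (n + 1) * Z) - h' ^ 2 • linSeq h' Z a b n

theorem exchangeTriple_linSeq {K R : Type*} [CommRing K] [Ring R] [Algebra K R] {h h' : K}
    {Z a b : R} (hh : h * h' = 1) (H : ExchangeTriple h h' Z a b (linSeq h' Z a b 2)) (n : ℕ) :
    ExchangeTriple h h' Z (linSeq h' Z a b n) (linSeq h' Z a b (n + 1))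
      (linSeq h' Z a b (n + 2)) := by
  induction n with
  | zero => exact H
  | succ n ih => exact ih.step hh

/-! ### The bar-involution as an anti-automorphism -/

theorem qh_mul_neg (r : ℤ) : qh r * qh (-r) = 1 := by
  rw [← QTorus.qh_add, add_neg_cancel, QTorus.qh_zero]

theorem qh_pow (r : ℤ) (n : ℕ) : qh r ^ n = qh (n * r) := by
  rw [qh, qh, LaurentPolynomial.T_pow]

theorem isUnit_qh (r : ℤ) : IsUnit (qh r) := LaurentPolynomial.isUnit_T r

theorem invert_qh (r : ℤ) : LaurentPolynomial.invert (qh r) = qh (-r) :=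
  LaurentPolynomial.invert_T r

namespace QTorus

theorem bar_smul (c : Coeff) (x : QTorus) : bar (c • x) = LaurentPolynomial.invert c • bar x := by
  induction x using induction_on with
  | h0 => simp only [smul_zero, map_zero]
  | hadd a b ha hb => simp only [smul_add, map_add, ha, hb]
  | hterm u a => simp only [smul_term, bar_term, map_mul]

theorem bar_mul (x y : QTorus) : bar (x * y) = bar y * bar x := by
  induction x using induction_on with
  | h0 => simp only [zero_mul, mul_zero, map_zero]
  | hadd a b ha hb => simp only [add_mul, mul_add, map_add, ha, hb]
  | hterm u a =>
  induction y using induction_on with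
  | h0 => simp only [zero_mul, mul_zero, map_zero]
  | hadd a b ha hb => simp only [add_mul, mul_add, map_add, ha, hb]
  | hterm v b =>
  have : -tw u v = tw v u := by simp only [tw]; ring
  simp only [term_mul_term, bar_term, map_mul, invert_qh, this, add_comm u v]
  congr 1
  ring

theorem bar_mono (a b : ℤ) : bar (mono a b) = mono a b := by
  simpa [qh_zero] using bar_qh_smul_mono 0 a b

theorem bar_one : bar 1 = 1 := bar_mono 0 0

theorem bar_pow {x : QTorus} (hx : bar x = x) (n : ℕ) : bar (x ^ n) = x ^ n := by
  induction n with
  | zero => exact bar_one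
  | succ n ih => rw [pow_succ, bar_mul, ih, hx, ← pow_succ, ← pow_succ']

theorem one_eq_mono : (1 : QTorus) = mono 0 0 := rfl

theorem mono_pow (a b : ℤ) (n : ℕ) : mono a b ^ n = mono (n * a) (n * b) := by
  induction n with
  | zero => simp [one_eq_mono]
  | succ n ih =>
    rw [pow_succ, ih, mono_mul_mono]
    have : -((n : ℤ) * b * a - n * a * b) = 0 := by ring
    rw [this, qh_zero, one_smul]
    push_cast
    congr 1 <;> ring

end QTorus

open QTorus

/-! ### The cluster variables inside the quantum torus -/

/-- The element `X_δ` of the quantum torus. -/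
def deltaT : QTorus :=
  mono (-1) (-2) + mono (-1) 2 + mono 1 (-2) + (qh (-1) + qh 1) • mono 0 (-2)

theorem bar_deltaT : bar deltaT = deltaT := by
  simp only [deltaT, map_add, bar_mono, bar_smul, invert_qh, neg_neg]
  rw [add_comm (qh 1)]

/-- The Laurent expansion of `X₀`. -/
def zeroVar : QTorus := mono 1 (-1) + mono 0 (-1)

/-- The Laurent expansion of `X₄`. -/
def fourVar : QTorus := mono (-1) 3 + mono (-1) (-1) + mono 0 (-1)

theorem exchangeTriple_initial :
    ExchangeTriple (qh 1) (qh (-1)) deltaT zeroVar (mono 0 1) fourVar := by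
  constructor <;>
  · simp only [deltaT, zeroVar, fourVar, add_mul, mul_add, mono_mul_mono, smul_mul_assoc,
      mul_smul_comm, smul_smul, smul_add, add_smul, sub_smul, one_smul, mono_pow, qh_pow,
      ← qh_add, one_eq_mono]
    norm_num [qh_zero]
    try abel

/-- The Laurent expansions of `X₂, X₄, X₆, …`. -/
def evenFwd : ℕ → QTorus := linSeq (qh (-1)) deltaT (mono 0 1) fourVar

/-- The Laurent expansions of `X₂, X₀, X₋₂, …`. -/
def evenBwd : ℕ → QTorus := linSeq (qh 1) deltaT (mono 0 1) zeroVar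

/-- The Laurent expansion of `X_{2m}`. -/
def evenVar (m : ℤ) : QTorus := if 1 ≤ m then evenFwd (m - 1).toNat else evenBwd (1 - m).toNat

/-- The Laurent expansion of `X_{2m+1} = q^{-1/2} (X_{2m} X_{2m+2} - 1)`. -/
def oddVar (m : ℤ) : QTorus := qh (-1) • (evenVar m * evenVar (m + 1) - 1)

/-- The Laurent expansion of `X_k`. -/
def torusVar (k : ℤ) : QTorus := if Even k then evenVar (k / 2) else oddVar (k / 2)

theorem qh_neg_mul (r : ℤ) : qh (-r) * qh r = 1 := by
  simpa using qh_mul_neg (-r)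

theorem evenVar_fwd (n : ℕ) : evenVar (n + 1) = evenFwd n := by
  rw [evenVar, if_pos (by omega)]
  congr 1
  omega

theorem evenVar_bwd (n : ℕ) : evenVar (1 - n) = evenBwd n := by
  rw [evenVar]
  split_ifs with h
  · obtain rfl : n = 0 := by omega
    simp [evenFwd, evenBwd, linSeq]
  · congr 1
    omega

theorem evenVar_zero : evenVar 0 = zeroVar := by
  have h := evenVar_bwd 1
  rw [Nat.cast_one, sub_self] at h
  rw [h, evenBwd, linSeq]

theorem evenVar_one : evenVar 1 = mono 0 1 := by
  have h := evenVar_fwd 0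
  rw [Nat.cast_zero, zero_add] at h
  rw [h, evenFwd, linSeq]

theorem exchangeTriple_evenVar (m : ℤ) :
    ExchangeTriple (qh 1) (qh (-1)) deltaT (evenVar (m - 1)) (evenVar m) (evenVar (m + 1)) := by
  have h1 := qh_mul_neg 1
  have h2 := qh_neg_mul 1
  rcases lt_trichotomy m 1 with h | rfl | h
  · obtain ⟨n, rfl⟩ : ∃ n : ℕ, m = 1 - (n + 1 : ℕ) := ⟨(-m).toNat, by omega⟩
    have := exchangeTriple_linSeq h2 ((exchangeTriple_initial.swap h1).step h2) n
    have := this.swap h2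
    rw [evenVar_bwd, show 1 - ((n + 1 : ℕ) : ℤ) + 1 = 1 - n by push_cast; ring, evenVar_bwd,
      show 1 - ((n + 1 : ℕ) : ℤ) - 1 = 1 - (n + 2 : ℕ) by push_cast; ring, evenVar_bwd]
    exact this
  · have e : fourVar = evenVar (1 + 1) := by
      have := evenVar_fwd 1
      rw [Nat.cast_one] at this
      rw [this, evenFwd, linSeq]
    rw [sub_self, evenVar_zero, evenVar_one, ← e]
    exact exchangeTriple_initial
  · obtain ⟨n, rfl⟩ : ∃ n : ℕ, m = (n + 1 : ℕ) + 1 := ⟨(m - 2).toNat, by omega⟩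
    have := exchangeTriple_linSeq h1 (exchangeTriple_initial.step h1) n
    rw [evenVar_fwd, show ((n + 1 : ℕ) : ℤ) + 1 - 1 = n + 1 by push_cast; ring, evenVar_fwd,
      show ((n + 1 : ℕ) : ℤ) + 1 + 1 = (n + 2 : ℕ) + 1 by push_cast; ring, evenVar_fwd]
    exact this

theorem evenVar_comm (m : ℤ) : evenVar m * evenVar (m + 1)
    = qh 2 • (evenVar (m + 1) * evenVar m) + (1 - qh 2) • 1 := by
  have := (exchangeTriple_evenVar m).comm_right (qh_mul_neg 1)
  rwa [qh_pow, Nat.cast_ofNat, mul_one] at this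

theorem oddVar_eq (m : ℤ) : oddVar m = qh 1 • (evenVar (m + 1) * evenVar m - 1) := by
  have h2 : qh 2 = qh 1 * qh 1 := by rw [← qh_add]; norm_num
  have := qh_mul_neg 1
  rw [oddVar, evenVar_comm]
  match_scalars <;> grind

theorem evenVar_mul_evenVar (m : ℤ) :
    evenVar m * evenVar (m + 1) = qh 1 • oddVar m + 1 := by
  rw [oddVar, smul_smul, qh_mul_neg, one_smul, sub_add_cancel]

theorem evenVar_mul_evenVar' (m : ℤ) :
    evenVar (m + 1) * evenVar m = qh (-1) • oddVar m + 1 := by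
  rw [oddVar_eq, smul_smul, qh_neg_mul, one_smul, sub_add_cancel]

theorem oddVar_mul_oddVar (m : ℤ) :
    oddVar (m - 1) * oddVar m = qh 4 • evenVar m ^ 4 + 1 := by
  have := (exchangeTriple_evenVar m).exchange (qh_mul_neg 1)
  rw [qh_pow, Nat.cast_ofNat, mul_one] at this
  rw [oddVar, oddVar, sub_add_cancel]
  exact this

theorem torusVar_two_mul (m : ℤ) : torusVar (2 * m) = evenVar m := by
  rw [torusVar, if_pos (even_two_mul m), Int.mul_ediv_cancel_left m two_ne_zero]

theorem torusVar_two_mul_add_one (m : ℤ) : torusVar (2 * m + 1) = oddVar m := by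
  rw [torusVar, if_neg (by simp)]
  congr 1
  omega

theorem bar_evenVar (m : ℤ) : bar (evenVar m) = evenVar m := by
  have key (m : ℤ) (h0 : bar (evenVar (m - 1)) = evenVar (m - 1))
      (h1 : bar (evenVar m) = evenVar m) : bar (evenVar (m + 1)) = evenVar (m + 1) := by
    have H := exchangeTriple_evenVar m
    conv_lhs => rw [H.right_eq (qh_mul_neg 1)]
    rw [map_sub, bar_smul, bar_smul, bar_mul, bar_deltaT, h0, h1, map_pow, invert_qh, neg_neg,
      ← H.right_eq' (qh_mul_neg 1)]
  have key' (m : ℤ) (h0 : bar (evenVar (m + 1)) = evenVar (m + 1))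
      (h1 : bar (evenVar m) = evenVar m) : bar (evenVar (m - 1)) = evenVar (m - 1) := by
    have H := (exchangeTriple_evenVar m).swap (qh_mul_neg 1)
    conv_lhs => rw [H.right_eq (qh_neg_mul 1)]
    rw [map_sub, bar_smul, bar_smul, bar_mul, bar_deltaT, h0, h1, map_pow, invert_qh,
      ← H.right_eq' (qh_neg_mul 1)]
  have h0 : bar (evenVar 0) = evenVar 0 := by
    rw [evenVar_zero, zeroVar, map_add, bar_mono, bar_mono]
  have h1 : bar (evenVar 1) = evenVar 1 := by rw [evenVar_one, bar_mono]
  suffices h : bar (evenVar m) = evenVar m ∧ bar (evenVar (m + 1)) = evenVar (m + 1) from h.1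
  induction m with
  | zero => exact ⟨h0, h1⟩
  | succ n ih => exact ⟨ih.2, key _ (by simpa using ih.1) ih.2⟩
  | pred n ih => exact ⟨key' _ ih.2 ih.1, by simpa using ih.1⟩

theorem bar_oddVar (m : ℤ) : bar (oddVar m) = oddVar m := by
  rw [oddVar_eq, bar_smul, map_sub, bar_mul, bar_evenVar, bar_evenVar, bar_one, invert_qh,
    ← oddVar, ← oddVar_eq]

theorem bar_torusVar (k : ℤ) : bar (torusVar k) = torusVar k := by
  rw [torusVar]
  split_ifs
  exacts [bar_evenVar _, bar_oddVar _]

theorem torusVar_comm (k : ℤ) :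
    torusVar k * torusVar (k + 1) = qh 2 • (torusVar (k + 1) * torusVar k) := by
  obtain ⟨m, rfl | rfl⟩ := Int.even_or_odd' k
  · have hl : evenVar m * oddVar m = qh 1 • (evenVar m * (evenVar (m + 1) * evenVar m - 1)) := by
      rw [oddVar_eq, mul_smul_comm]
    have hr : oddVar m * evenVar m = qh (-1) • ((evenVar m * evenVar (m + 1) - 1) * evenVar m) := by
      rw [oddVar, smul_mul_assoc]
    rw [torusVar_two_mul_add_one, torusVar_two_mul, hl, hr, smul_smul, ← qh_add]
    norm_num [mul_sub, sub_mul, mul_assoc]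
  · have e : 2 * m + 1 + 1 = 2 * (m + 1) := by ring
    have hl : oddVar m * evenVar (m + 1)
        = qh 1 • ((evenVar (m + 1) * evenVar m - 1) * evenVar (m + 1)) := by
      rw [oddVar_eq, smul_mul_assoc]
    have hr : evenVar (m + 1) * oddVar m
        = qh (-1) • (evenVar (m + 1) * (evenVar m * evenVar (m + 1) - 1)) := by
      rw [oddVar, mul_smul_comm]
    rw [e, torusVar_two_mul_add_one, torusVar_two_mul, hl, hr, smul_smul, ← qh_add]
    norm_num [mul_sub, sub_mul, mul_assoc]

theorem oddVar_zero : oddVar 0 = mono 1 0 := by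
  rw [oddVar, evenVar_zero, zero_add, evenVar_one, zeroVar, add_mul, mono_mul_mono, mono_mul_mono]
  norm_num [qh_zero, ← one_eq_mono, smul_smul, ← qh_add]

theorem torusVar_one : torusVar 1 = mono 1 0 :=
  (torusVar_two_mul_add_one 0).trans oddVar_zero

theorem torusVar_two : torusVar 2 = mono 0 1 :=
  (torusVar_two_mul 1).trans evenVar_one

theorem torusVar_mul_odd (m : ℤ) :
    torusVar (2 * m) * torusVar (2 * m + 2) = qh 1 • torusVar (2 * m + 1) + 1 := by
  rw [show 2 * m + 2 = 2 * (m + 1) by ring, torusVar_two_mul, torusVar_two_mul,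
    torusVar_two_mul_add_one, evenVar_mul_evenVar]

theorem torusVar_mul_even (m : ℤ) :
    torusVar (2 * m - 1) * torusVar (2 * m + 1) = qh 4 • torusVar (2 * m) ^ 4 + 1 := by
  rw [show 2 * m - 1 = 2 * (m - 1) + 1 by ring, torusVar_two_mul, torusVar_two_mul_add_one,
    torusVar_two_mul_add_one, oddVar_mul_oddVar]

/-! ### Pointed elements -/

/-- An element of the quantum torus is pointed at `v` if `X^v` has an invertible coefficient and
`v` is the componentwise least exponent that occurs. -/
def Pointed (v : ℤ × ℤ) (x : QTorus) : Prop :=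
  IsUnit (x.coeff v) ∧ ∀ w, x.coeff w ≠ 0 → v ≤ w

namespace Pointed

variable {v w : ℤ × ℤ} {x y : QTorus}

theorem ne_zero (h : Pointed v x) : x ≠ 0 := by
  rintro rfl
  exact h.1.ne_zero rfl

protected theorem mul (hx : Pointed v x) (hy : Pointed w y) : Pointed (v + w) (x * y) := by
  constructor
  · rw [coeff_mul, Finset.sum_eq_single_of_mem v (Finsupp.mem_support_iff.mpr hx.1.ne_zero),
      Finset.sum_eq_single_of_mem w (Finsupp.mem_support_iff.mpr hy.1.ne_zero), if_pos rfl]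
    · exact (hx.1.mul hy.1).mul (isUnit_qh _)
    · exact fun w' _ hne => if_neg fun he => hne (add_left_cancel he)
    · refine fun v' hv' hne => Finset.sum_eq_zero fun w' hw' => if_neg fun he => hne ?_
      have h1 := hx.2 v' (Finsupp.mem_support_iff.mp hv')
      have h2 := hy.2 w' (Finsupp.mem_support_iff.mp hw')
      exact (((add_eq_add_iff_eq_and_eq h1 h2).mp he.symm).1).symm
  · intro p hp
    rw [coeff_mul] at hp
    obtain ⟨v', hv', hp⟩ := Finset.exists_ne_zero_of_sum_ne_zero hp
    obtain ⟨w', hw', hp⟩ := Finset.exists_ne_zero_of_sum_ne_zero hp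
    obtain rfl : v' + w' = p := by
      by_contra h
      exact hp (if_neg h)
    exact add_le_add (hx.2 v' (Finsupp.mem_support_iff.mp hv'))
      (hy.2 w' (Finsupp.mem_support_iff.mp hw'))

protected theorem smul {c : Coeff} (hc : IsUnit c) (hx : Pointed v x) : Pointed v (c • x) :=
  ⟨hc.mul hx.1, fun w hw => hx.2 w fun h => hw (by
    rw [coeff_smul, Finsupp.smul_apply, h, smul_zero])⟩

protected theorem mono (a b : ℤ) : Pointed (a, b) (mono a b) := by
  constructor
  · rw [mono, coeff_term, Finsupp.single_eq_same]
    exact isUnit_one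
  · intro w hw
    rw [mono, coeff_term] at hw
    exact le_of_eq (by_contra fun h => hw (Finsupp.single_eq_of_ne (Ne.symm h)))

protected theorem one : Pointed 0 (1 : QTorus) := Pointed.mono 0 0

protected theorem pow (hx : Pointed v x) (n : ℕ) : Pointed (n • v) (x ^ n) := by
  induction n with
  | zero => simpa using Pointed.one
  | succ n ih => rw [pow_succ, succ_nsmul]; exact ih.mul hx

/-- Adding terms with strictly larger exponents does not affect pointedness. -/
theorem add_of_lt (hx : Pointed v x) (hy : ∀ u, y.coeff u ≠ 0 → v < u) : Pointed v (x + y) := by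
  have hyv : y.coeff v = 0 := by_contra fun h => lt_irrefl v (hy v h)
  constructor
  · rw [coeff_add, Finsupp.add_apply, hyv, add_zero]
    exact hx.1
  · intro w hw
    by_cases h : y.coeff w = 0
    · rw [coeff_add, Finsupp.add_apply, h, add_zero] at hw
      exact hx.2 w hw
    · exact (hy w h).le

theorem lt_of_smul (hy : Pointed w y) (h : v < w) (c : Coeff) :
    ∀ u, (c • y).coeff u ≠ 0 → v < u := fun u hu =>
  h.trans_le (hy.2 u fun h0 => hu (by rw [coeff_smul, Finsupp.smul_apply, h0, smul_zero]))

/-- A combination `x + c y` of pointed elements, where `y` has the larger exponent. -/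
theorem add_smul (hx : Pointed v x) (hy : Pointed w y) (h : v < w) (c : Coeff) :
    Pointed v (x + c • y) := hx.add_of_lt (hy.lt_of_smul h c)

end Pointed

theorem lt_of_coords {a b c d : ℤ} (h : a ≤ c ∧ b ≤ d ∧ a + b < c + d) : (a, b) < (c, d) := by
  rw [Prod.mk_lt_mk]
  omega

theorem pointed_deltaT : Pointed (-1, -2) deltaT := by
  have h := ((Pointed.mono (-1) (-2)).add_smul (Pointed.mono (-1) 2)
    (lt_of_coords (by norm_num)) 1).add_smul (Pointed.mono 1 (-2)) (lt_of_coords (by norm_num)) 1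
  rw [one_smul, one_smul] at h
  exact h.add_smul (Pointed.mono 0 (-2)) (lt_of_coords (by norm_num)) _

theorem pointed_zeroVar : Pointed (0, -1) zeroVar := by
  have h := (Pointed.mono 0 (-1)).add_smul (Pointed.mono 1 (-1)) (lt_of_coords (by norm_num)) 1
  rwa [one_smul, add_comm] at h

theorem pointed_fourVar : Pointed (-1, -1) fourVar := by
  have h := ((Pointed.mono (-1) (-1)).add_smul (Pointed.mono (-1) 3)
    (lt_of_coords (by norm_num)) 1).add_smul (Pointed.mono 0 (-1)) (lt_of_coords (by norm_num)) 1
  rwa [one_smul, one_smul, add_comm (mono (-1) (-1))] at h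

theorem Pointed.linSeq_succ {r : ℤ} {a b : QTorus} {n : ℕ} {v w : ℤ × ℤ}
    (h0 : Pointed v (linSeq (qh r) deltaT a b n))
    (h1 : Pointed w (linSeq (qh r) deltaT a b (n + 1))) (h : w + (-1, -2) < v) :
    Pointed (w + (-1, -2)) (linSeq (qh r) deltaT a b (n + 2)) := by
  have := ((h1.mul pointed_deltaT).smul (isUnit_qh r)).add_smul h0 h (-qh r ^ 2)
  rwa [neg_smul, ← sub_eq_add_neg] at this

theorem pointed_evenFwd (n : ℕ) : Pointed (-(n : ℤ), 1 - 2 * n) (evenFwd n) := by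
  suffices h : Pointed (-(n : ℤ), 1 - 2 * n) (evenFwd n) ∧
      Pointed (-((n + 1 : ℕ) : ℤ), 1 - 2 * ((n + 1 : ℕ) : ℤ)) (evenFwd (n + 1)) from h.1
  induction n with
  | zero => exact ⟨Pointed.mono 0 1, pointed_fourVar⟩
  | succ n ih =>
    have h : Pointed _ (evenFwd (n + 2)) := Pointed.linSeq_succ ih.1 ih.2 (by
      rw [Prod.mk_add_mk]
      exact lt_of_coords (by push_cast; omega))
    refine ⟨ih.2, ?_⟩
    rw [Prod.mk_add_mk] at h
    convert h using 2 <;> push_cast <;> ring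

theorem pointed_evenBwd (n : ℕ) : Pointed (-(n : ℤ), -1 - 2 * n) (evenBwd (n + 1)) := by
  suffices h : Pointed (-(n : ℤ), -1 - 2 * n) (evenBwd (n + 1)) ∧
      Pointed (-((n + 1 : ℕ) : ℤ), -1 - 2 * ((n + 1 : ℕ) : ℤ)) (evenBwd (n + 2)) from h.1
  induction n with
  | zero =>
    have h : Pointed _ (evenBwd (0 + 2)) :=
      Pointed.linSeq_succ (Pointed.mono 0 1) pointed_zeroVar (by
        rw [Prod.mk_add_mk]
        exact lt_of_coords (by norm_num))
    refine ⟨pointed_zeroVar, ?_⟩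
    rw [Prod.mk_add_mk] at h
    convert h using 2 <;> norm_num
  | succ n ih =>
    have h : Pointed _ (evenBwd (n + 1 + 2)) := Pointed.linSeq_succ ih.1 ih.2 (by
      rw [Prod.mk_add_mk]
      exact lt_of_coords (by push_cast; omega))
    refine ⟨ih.2, ?_⟩
    rw [Prod.mk_add_mk] at h
    convert h using 2 <;> push_cast <;> ring

/-- The least exponent of `X_k`; its negative is the denominator vector. -/
def lead (k : ℤ) : ℤ × ℤ :=
  if 2 ≤ k then if Even k then (1 - k / 2, 3 - k) else (2 - k, 6 - 2 * k)
  else if Even k then (k / 2, k - 1) else (k, 2 * k - 2)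

theorem pointed_evenVar_of_pos {m : ℤ} (hm : 1 ≤ m) : Pointed (1 - m, 3 - 2 * m) (evenVar m) := by
  obtain ⟨n, rfl⟩ : ∃ n : ℕ, m = n + 1 := ⟨(m - 1).toNat, by omega⟩
  rw [evenVar_fwd]
  convert pointed_evenFwd n using 2 <;> ring

theorem pointed_evenVar_of_nonpos {m : ℤ} (hm : m ≤ 0) : Pointed (m, 2 * m - 1) (evenVar m) := by
  obtain ⟨n, rfl⟩ : ∃ n : ℕ, m = 1 - (n + 1 : ℕ) := ⟨(-m).toNat, by omega⟩
  rw [evenVar_bwd]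
  convert pointed_evenBwd n using 2 <;> push_cast <;> ring

theorem pointed_oddVar_of_pos {m : ℤ} (hm : 1 ≤ m) : Pointed (1 - 2 * m, 4 - 4 * m) (oddVar m) := by
  have h := ((pointed_evenVar_of_pos hm).mul
    (pointed_evenVar_of_pos (by omega : 1 ≤ m + 1))).add_smul
    (w := (0, 0)) Pointed.one (by rw [Prod.mk_add_mk]; exact lt_of_coords (by omega)) (-1)
  rw [neg_one_smul, ← sub_eq_add_neg] at h
  rw [oddVar]
  convert h.smul (isUnit_qh (-1)) using 1
  rw [Prod.mk_add_mk]
  congr 1 <;> ring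

theorem pointed_oddVar_of_neg {m : ℤ} (hm : m < 0) : Pointed (2 * m + 1, 4 * m) (oddVar m) := by
  have h := ((pointed_evenVar_of_nonpos hm.le).mul
    (pointed_evenVar_of_nonpos (by omega : m + 1 ≤ 0))).add_smul
    (w := (0, 0)) Pointed.one (by rw [Prod.mk_add_mk]; exact lt_of_coords (by omega)) (-1)
  rw [neg_one_smul, ← sub_eq_add_neg] at h
  rw [oddVar]
  convert h.smul (isUnit_qh (-1)) using 1
  rw [Prod.mk_add_mk]
  congr 1 <;> ring

theorem pointed_torusVar (k : ℤ) : Pointed (lead k) (torusVar k) := by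
  obtain ⟨m, rfl | rfl⟩ := Int.even_or_odd' k
  · rw [torusVar_two_mul, lead, if_pos (even_two_mul m), if_pos (even_two_mul m)]
    split_ifs with h
    · convert pointed_evenVar_of_pos (by omega : 1 ≤ m) using 2
      omega
    · convert pointed_evenVar_of_nonpos (by omega : m ≤ 0) using 2
      omega
  · have ho : ¬ Even (2 * m + 1) := by simp
    rw [torusVar_two_mul_add_one, lead, if_neg ho, if_neg ho]
    split_ifs with h
    · convert pointed_oddVar_of_pos (by omega : 1 ≤ m) using 2 <;> ring
    · rcases eq_or_ne m 0 with rfl | h0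
      · rw [oddVar_zero]
        exact Pointed.mono 1 0
      · convert pointed_oddVar_of_neg (by omega : m < 0) using 2; ring

theorem torusVar_ne_zero (k : ℤ) : torusVar k ≠ 0 := (pointed_torusVar k).ne_zero

/-! ### The fan of denominator vectors -/

/-- The least exponent of the cluster monomial in `X_m^a X_{m+1}^b`. -/
def leadMono (m : ℤ) (a b : ℕ) : ℤ × ℤ := a • lead m + b • lead (m + 1)

/-- Twice the `k`-th ray `lead k` is `mult k` times a vector that is affine-linear in `k` on either
side of the limiting ray of `X_δ`. -/
def mult (k : ℤ) : ℕ := if Even k then 1 else 2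

theorem mult_pos (k : ℤ) : 0 < mult k := by
  rw [mult]
  split_ifs <;> norm_num

theorem lead_right {k : ℤ} (hk : 2 ≤ k) :
    2 * (lead k).1 = mult k * (2 - k) ∧ (lead k).2 = mult k * (3 - k) := by
  rw [lead, if_pos hk, mult]
  split_ifs with h
  · obtain ⟨j, rfl⟩ := h
    dsimp only
    omega
  · dsimp only
    omega

theorem lead_left {k : ℤ} (hk : k ≤ 1) :
    2 * (lead k).1 = mult k * k ∧ (lead k).2 = mult k * (k - 1) := by
  rw [lead, if_neg (by omega), mult]
  split_ifs with h
  · obtain ⟨j, rfl⟩ := h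
    dsimp only
    omega
  · dsimp only
    omega

theorem leadMono_fst (m : ℤ) (a b : ℕ) :
    (leadMono m a b).1 = a * (lead m).1 + b * (lead (m + 1)).1 := by
  simp [leadMono]

theorem leadMono_snd (m : ℤ) (a b : ℕ) :
    (leadMono m a b).2 = a * (lead m).2 + b * (lead (m + 1)).2 := by
  simp [leadMono]

/-- On the right-hand side of the fan, `m - 2` and the weight of `X_{m+1}` are the quotient and the
remainder of a division with the linear form `v.2 - 2 * v.1` as divisor. This determines the cone
that contains a given vector. -/
theorem leadMono_right {m : ℤ} (hm : 2 ≤ m) (a b : ℕ) :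
    (leadMono m a b).2 - 2 * (leadMono m a b).1 = a * mult m + b * mult (m + 1) ∧
      -2 * (leadMono m a b).1 =
        ((leadMono m a b).2 - 2 * (leadMono m a b).1) * (m - 2) + b * mult (m + 1) := by
  obtain ⟨h1, h2⟩ := lead_right hm
  obtain ⟨h3, h4⟩ := lead_right (by omega : 2 ≤ m + 1)
  rw [leadMono_fst, leadMono_snd]
  have key : (a * (lead m).2 + b * (lead (m + 1)).2) -
      2 * (a * (lead m).1 + b * (lead (m + 1)).1) = a * mult m + b * mult (m + 1) := by
    linear_combination (a : ℤ) * h2 + (b : ℤ) * h4 - (a : ℤ) * h1 - (b : ℤ) * h3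
  refine ⟨key, ?_⟩
  rw [key]
  linear_combination -(a : ℤ) * h1 - (b : ℤ) * h3

/-- The analogue of `leadMono_right` on the left-hand side of the fan, where the quotient is `m`. -/
theorem leadMono_left {m : ℤ} (hm : m ≤ 0) (a b : ℕ) :
    2 * (leadMono m a b).1 - (leadMono m a b).2 = a * mult m + b * mult (m + 1) ∧
      2 * (leadMono m a b).1 =
        (2 * (leadMono m a b).1 - (leadMono m a b).2) * m + b * mult (m + 1) := by
  obtain ⟨h1, h2⟩ := lead_left (by omega : m ≤ 1)
  obtain ⟨h3, h4⟩ := lead_left (by omega : m + 1 ≤ 1)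
  rw [leadMono_fst, leadMono_snd]
  have key : 2 * (a * (lead m).1 + b * (lead (m + 1)).1) -
      (a * (lead m).2 + b * (lead (m + 1)).2) = a * mult m + b * mult (m + 1) := by
    linear_combination -(a : ℤ) * h2 - (b : ℤ) * h4 + (a : ℤ) * h1 + (b : ℤ) * h3
  refine ⟨key, ?_⟩
  rw [key]
  linear_combination (a : ℤ) * h1 + (b : ℤ) * h3

theorem leadMono_one (a b : ℕ) : leadMono 1 a b = ((a : ℤ), (b : ℤ)) := by
  simp [leadMono, lead]

theorem div_unique {s m m' B B' : ℤ} (h : s * m + B = s * m' + B') (h0 : 0 ≤ B) (h1 : B < s)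
    (h0' : 0 ≤ B') (h1' : B' < s) : m = m' ∧ B = B' := by
  have hs : 0 < s := h0.trans_lt h1
  have e := (Int.ediv_emod_unique (a := s * m + B) hs).mpr ⟨add_comm B _, h0, h1⟩
  have e' := (Int.ediv_emod_unique (a := s * m' + B') hs).mpr ⟨add_comm B' _, h0', h1'⟩
  rw [h] at e
  exact ⟨e.1.symm.trans e'.1, e.2.symm.trans e'.2⟩

theorem right_region {m : ℤ} (hm : 2 ≤ m) {a : ℕ} (ha : 0 < a) (b : ℕ) :
    (leadMono m a b).1 ≤ 0 ∧ 2 * (leadMono m a b).1 < (leadMono m a b).2 := by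
  obtain ⟨h1, h2⟩ := leadMono_right hm a b
  have hA : (0 : ℤ) < a * mult m := by exact_mod_cast Nat.mul_pos ha (mult_pos m)
  have hB : (0 : ℤ) ≤ b * mult (m + 1) := by positivity
  rw [h1] at h2
  have := mul_nonneg (by omega : (0 : ℤ) ≤ a * mult m + b * mult (m + 1))
    (by omega : (0 : ℤ) ≤ m - 2)
  omega

theorem left_region {m : ℤ} (hm : m ≤ 0) {a : ℕ} (ha : 0 < a) (b : ℕ) :
    (leadMono m a b).2 < 0 ∧ (leadMono m a b).2 < 2 * (leadMono m a b).1 := by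
  obtain ⟨h1, h2⟩ := leadMono_left hm a b
  have hA : (0 : ℤ) < a * mult m := by exact_mod_cast Nat.mul_pos ha (mult_pos m)
  have hB : (0 : ℤ) ≤ b * mult (m + 1) := by positivity
  rw [h1] at h2
  have := mul_nonneg (by omega : (0 : ℤ) ≤ a * mult m + b * mult (m + 1))
    (by omega : (0 : ℤ) ≤ -m)
  rw [mul_neg] at this
  omega

theorem leadMono_ne_delta (m : ℤ) {a : ℕ} (ha : 0 < a) (b n : ℕ) :
    leadMono m a b ≠ (-(n : ℤ), -2 * (n : ℤ)) := by
  intro h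
  have h1 := congrArg Prod.fst h
  have h2 := congrArg Prod.snd h
  dsimp only at h1 h2
  rcases (by omega : 2 ≤ m ∨ m ≤ 0 ∨ m = 1) with hm | hm | rfl
  · have := right_region hm ha b
    omega
  · have := left_region hm ha b
    omega
  · rw [leadMono_one] at h1
    dsimp only at h1
    omega

/-- A vector lies in the relative interior of at most one cone of the fan: it determines a
cluster monomial in the normal form `0 < a`. -/
theorem leadMono_injective {m m' : ℤ} {a a' b b' : ℕ} (ha : 0 < a) (ha' : 0 < a')
    (h : leadMono m a b = leadMono m' a' b') : m = m' ∧ a = a' ∧ b = b' := by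
  have hA : (0 : ℤ) < a * mult m := by exact_mod_cast Nat.mul_pos ha (mult_pos m)
  have hA' : (0 : ℤ) < a' * mult m' := by exact_mod_cast Nat.mul_pos ha' (mult_pos m')
  have hB : (0 : ℤ) ≤ b * mult (m + 1) := by positivity
  have hB' : (0 : ℤ) ≤ b' * mult (m' + 1) := by positivity
  have finish (hm : m = m') (eB : (b : ℤ) * mult (m + 1) = b' * mult (m' + 1))
      (eA : (a : ℤ) * mult m = a' * mult m') : m = m' ∧ a = a' ∧ b = b' := by
    subst hm
    refine ⟨rfl, ?_, ?_⟩
    · exact Nat.eq_of_mul_eq_mul_right (mult_pos m) (by exact_mod_cast eA)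
    · exact Nat.eq_of_mul_eq_mul_right (mult_pos (m + 1)) (by exact_mod_cast eB)
  have regions (m : ℤ) {a : ℕ} (ha : 0 < a) (b : ℕ) :
      (2 ≤ m ∧ (leadMono m a b).1 ≤ 0 ∧ 2 * (leadMono m a b).1 < (leadMono m a b).2) ∨
      (m ≤ 0 ∧ (leadMono m a b).2 < 0 ∧ (leadMono m a b).2 < 2 * (leadMono m a b).1) ∨
      (m = 1 ∧ 0 < (leadMono m a b).1 ∧ 0 ≤ (leadMono m a b).2) := by
    rcases (by omega : 2 ≤ m ∨ m ≤ 0 ∨ m = 1) with hm | hm | rfl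
    · exact Or.inl ⟨hm, right_region hm ha b⟩
    · exact Or.inr (Or.inl ⟨hm, left_region hm ha b⟩)
    · rw [leadMono_one]
      exact Or.inr (Or.inr ⟨rfl, Int.natCast_pos.mpr ha, Int.natCast_nonneg b⟩)
  have r := regions m ha b
  have r' := regions m' ha' b'
  rcases (by rw [h] at r; omega : (2 ≤ m ∧ 2 ≤ m') ∨ (m ≤ 0 ∧ m' ≤ 0) ∨ (m = 1 ∧ m' = 1)) with
    ⟨hm, hm'⟩ | ⟨hm, hm'⟩ | ⟨rfl, rfl⟩
  · obtain ⟨h1, h2⟩ := leadMono_right hm a b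
    obtain ⟨h1', h2'⟩ := leadMono_right hm' a' b'
    rw [h] at h1 h2
    obtain ⟨e, eB⟩ := div_unique (h2.symm.trans h2') hB (by omega) hB' (by omega)
    exact finish (by omega) eB (by omega)
  · obtain ⟨h1, h2⟩ := leadMono_left hm a b
    obtain ⟨h1', h2'⟩ := leadMono_left hm' a' b'
    rw [h] at h1 h2
    obtain ⟨e, eB⟩ := div_unique (h2.symm.trans h2') hB (by omega) hB' (by omega)
    exact finish (by omega) eB (by omega)
  · rw [leadMono_one, leadMono_one] at h
    have h1 := congrArg Prod.fst h
    have h2 := congrArg Prod.snd h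
    dsimp only at h1 h2
    omega

theorem lead_two_mul {j : ℤ} (hj : 1 ≤ j) : lead (2 * j) = (1 - j, 3 - 2 * j) := by
  rw [lead, if_pos (by omega), if_pos (even_two_mul j), Int.mul_ediv_cancel_left j two_ne_zero]

theorem lead_two_mul_add_one {j : ℤ} (hj : 1 ≤ j) :
    lead (2 * j + 1) = (1 - 2 * j, 4 - 4 * j) := by
  rw [lead, if_pos (by omega), if_neg (by simp)]
  ext <;> (dsimp only; ring)

theorem lead_two_mul_of_nonpos {j : ℤ} (hj : j ≤ 0) : lead (2 * j) = (j, 2 * j - 1) := by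
  rw [lead, if_neg (by omega), if_pos (even_two_mul j), Int.mul_ediv_cancel_left j two_ne_zero]

theorem lead_two_mul_add_one_of_nonpos {j : ℤ} (hj : j ≤ 0) :
    lead (2 * j + 1) = (2 * j + 1, 4 * j) := by
  rw [lead, if_neg (by omega), if_neg (by simp), show 2 * (2 * j + 1) - 2 = 4 * j by ring]

theorem exists_leadMono_eq {m a b : ℤ} (ha : 0 ≤ a) (hb : 0 ≤ b) {v : ℤ × ℤ}
    (h1 : a * (lead m).1 + b * (lead (m + 1)).1 = v.1)
    (h2 : a * (lead m).2 + b * (lead (m + 1)).2 = v.2) : ∃ m a b, leadMono m a b = v := by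
  refine ⟨m, a.toNat, b.toNat, Prod.ext ?_ ?_⟩
  · rw [leadMono_fst, Int.toNat_of_nonneg ha, Int.toNat_of_nonneg hb, h1]
  · rw [leadMono_snd, Int.toNat_of_nonneg ha, Int.toNat_of_nonneg hb, h2]

/-- The cones of the fan cover everything except for the ray of `X_δ`. -/
theorem exists_leadMono (v : ℤ × ℤ) :
    (∃ m a b, leadMono m a b = v) ∨ ∃ n : ℕ, v = (-(n : ℤ), -2 * (n : ℤ)) := by
  obtain ⟨x, y⟩ := v
  rcases (by omega : (x ≤ 0 ∧ 2 * x < y) ∨ (y < 0 ∧ y < 2 * x) ∨ (0 ≤ x ∧ 0 ≤ y) ∨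
      (x ≤ 0 ∧ y = 2 * x)) with ⟨hx, hy⟩ | ⟨hx, hy⟩ | ⟨hx, hy⟩ | ⟨hx, rfl⟩
  · left
    -- Division by `s` finds the cone: `k = m - 2` is the quotient, `B` the remainder.
    set s := y - 2 * x with hs
    have hdiv := Int.mul_ediv_add_emod (-2 * x) s
    have hB := Int.emod_nonneg (-2 * x) (by omega : s ≠ 0)
    have hB' := Int.emod_lt_of_pos (-2 * x) (by omega : 0 < s)
    have hk := Int.ediv_nonneg (by omega : 0 ≤ -2 * x) (by omega : 0 ≤ s)
    generalize -2 * x / s = k at *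
    generalize -2 * x % s = B at *
    obtain ⟨j, rfl | rfl⟩ := Int.even_or_odd' k
    · have hB2 : B = 2 * (-x - s * j) := by linear_combination hdiv
      refine exists_leadMono_eq (m := 2 * (j + 1)) (a := s - B) (b := -x - s * j) (by omega)
        (by omega) ?_ ?_
      · rw [lead_two_mul (by omega), lead_two_mul_add_one (by omega)]
        linear_combination (j : ℤ) * hB2
      · rw [lead_two_mul (by omega), lead_two_mul_add_one (by omega)]
        linear_combination (-1 + 2 * j : ℤ) * hB2 + hs
    · have hA : s - B = 2 * (x + s * (j + 1)) := by linear_combination -hdiv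
      refine exists_leadMono_eq (m := 2 * (j + 1) + 1) (a := x + s * (j + 1)) (b := B) (by omega)
        (by omega) ?_ ?_
      · rw [lead_two_mul_add_one (by omega), show 2 * (j + 1) + 1 + 1 = 2 * (j + 2) by ring,
          lead_two_mul (by omega)]
        linear_combination (j + 1 : ℤ) * hA
      · rw [lead_two_mul_add_one (by omega), show 2 * (j + 1) + 1 + 1 = 2 * (j + 2) by ring,
          lead_two_mul (by omega)]
        linear_combination (2 * j + 1 : ℤ) * hA + hs
  · left
    -- The same division, with the quotient `k = m`.
    set s := 2 * x - y with hs
    have hdiv := Int.mul_ediv_add_emod (2 * x) s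
    have hB := Int.emod_nonneg (2 * x) (by omega : s ≠ 0)
    have hB' := Int.emod_lt_of_pos (2 * x) (by omega : 0 < s)
    have hk : 2 * x / s ≤ 0 := by
      have := Int.ediv_lt_of_lt_mul (by omega : 0 < s) (by omega : 2 * x < 1 * s)
      omega
    generalize 2 * x / s = k at *
    generalize 2 * x % s = B at *
    obtain ⟨j, rfl | rfl⟩ := Int.even_or_odd' k
    · have hB2 : B = 2 * (x - s * j) := by linear_combination hdiv
      refine exists_leadMono_eq (m := 2 * j) (a := s - B) (b := x - s * j) (by omega)
        (by omega) ?_ ?_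
      · rw [lead_two_mul_of_nonpos (by omega), lead_two_mul_add_one_of_nonpos (by omega)]
        linear_combination (-j : ℤ) * hB2
      · rw [lead_two_mul_of_nonpos (by omega), lead_two_mul_add_one_of_nonpos (by omega)]
        linear_combination (1 - 2 * j : ℤ) * hB2 - hs
    · have hA : s - B = 2 * (s * (j + 1) - x) := by linear_combination -hdiv
      refine exists_leadMono_eq (m := 2 * j + 1) (a := s * (j + 1) - x) (b := B) (by omega)
        (by omega) ?_ ?_
      · rw [lead_two_mul_add_one_of_nonpos (by omega), show 2 * j + 1 + 1 = 2 * (j + 1) by ring,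
          lead_two_mul_of_nonpos (by omega)]
        linear_combination (-(j + 1) : ℤ) * hA
      · rw [lead_two_mul_add_one_of_nonpos (by omega), show 2 * j + 1 + 1 = 2 * (j + 1) by ring,
          lead_two_mul_of_nonpos (by omega)]
        linear_combination (-(2 * j + 1) : ℤ) * hA - hs
  · left
    refine ⟨1, x.toNat, y.toNat, ?_⟩
    rw [leadMono_one, Int.toNat_of_nonneg hx, Int.toNat_of_nonneg hy]
  · right
    exact ⟨(-x).toNat, by ext <;> dsimp only <;> omega⟩

/-! ### Pointed families -/

/-- The coefficient of `∑ c_w E_w` at an exponent that is minimal among the `w` with `c_w ≠ 0`: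
no other term contributes. -/
theorem coeff_linearCombination {E : ℤ × ℤ → QTorus} (hE : ∀ w, Pointed w (E w))
    (c : (ℤ × ℤ) →₀ Coeff) {v : ℤ × ℤ} (hv : ∀ w, c w ≠ 0 → w ≤ v → w = v) :
    (Finsupp.linearCombination Coeff E c).coeff v = c v * (E v).coeff v := by
  let φ : QTorus →+ Coeff :=
    { toFun := fun z => z.coeff v, map_zero' := rfl, map_add' := fun _ _ => rfl }
  change φ _ = _
  rw [Finsupp.linearCombination_apply, Finsupp.sum, map_sum]
  refine (Finset.sum_eq_single v (fun w hw hne => ?_) (fun hw => ?_)).trans rfl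
  · by_contra h
    refine hne (hv w (Finsupp.mem_support_iff.mp hw) ((hE w).2 v fun h0 => h ?_))
    change c w * (E w).coeff v = 0
    rw [h0, mul_zero]
  · rw [Finsupp.notMem_support_iff.mp hw, zero_smul, map_zero]

theorem exists_minimal_le {c : (ℤ × ℤ) →₀ Coeff} {w : ℤ × ℤ} (hw : c w ≠ 0) :
    ∃ v ≤ w, c v ≠ 0 ∧ ∀ u, c u ≠ 0 → u ≤ v → u = v := by
  obtain ⟨v, hvw, hv⟩ := c.support.exists_le_minimal (Finsupp.mem_support_iff.mpr hw)
  refine ⟨v, hvw, Finsupp.mem_support_iff.mp hv.1, fun u hu huv => ?_⟩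
  exact le_antisymm huv (hv.2 (Finsupp.mem_support_iff.mpr hu) huv)

theorem linearIndependent_of_pointed {E : ℤ × ℤ → QTorus} (hE : ∀ w, Pointed w (E w)) :
    LinearIndependent Coeff E := by
  rw [linearIndependent_iff]
  intro c hc
  by_contra h
  obtain ⟨w, hw⟩ := Finsupp.ne_iff.mp h
  obtain ⟨v, -, hv, hmin⟩ := exists_minimal_le hw
  have := coeff_linearCombination hE c hmin
  rw [hc] at this
  exact mul_ne_zero hv (hE v).1.ne_zero this.symm

/-- The expansion of a pointed element in a pointed family is unitriangular up to units. -/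
theorem exists_expansion {E : ℤ × ℤ → QTorus} (hE : ∀ w, Pointed w (E w)) {v : ℤ × ℤ}
    {x : QTorus} (hx : Pointed v x) (hmem : x ∈ Submodule.span Coeff (Set.range E)) :
    ∃ c : (ℤ × ℤ) →₀ Coeff, Finsupp.linearCombination Coeff E c = x ∧ IsUnit (c v) ∧
      ∀ w, c w ≠ 0 → v ≤ w := by
  obtain ⟨c, rfl⟩ := Finsupp.mem_span_range_iff_exists_finsupp.mp hmem
  change Pointed v (Finsupp.linearCombination Coeff E c) at hx
  have hge : ∀ w, c w ≠ 0 → v ≤ w := by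
    intro w hw
    obtain ⟨u, huw, hu, hmin⟩ := exists_minimal_le hw
    refine le_trans (hx.2 u ?_) huw
    rw [coeff_linearCombination hE c hmin]
    exact mul_ne_zero hu (hE u).1.ne_zero
  refine ⟨c, rfl, ?_, hge⟩
  have h := hx.1
  rw [coeff_linearCombination hE c fun w hw hwv => le_antisymm hwv (hge w hw)] at h
  exact isUnit_of_mul_isUnit_left h

/-- Suppose that a pointed family `B` lies in the span of a pointed family `E`. If the span of `B`
contains `E w` for all `w` outside of the open third quadrant, then it contains every `E w`: inside
the third quadrant the transition matrix is triangular for a well-founded order. -/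
theorem mem_span_of_pointed {E B : ℤ × ℤ → QTorus} (hE : ∀ w, Pointed w (E w))
    (hB : ∀ w, Pointed w (B w)) (hBE : ∀ w, B w ∈ Submodule.span Coeff (Set.range E))
    (hout : ∀ w, 0 ≤ w.1 ∨ 0 ≤ w.2 → E w ∈ Submodule.span Coeff (Set.range B)) (w : ℤ × ℤ) :
    E w ∈ Submodule.span Coeff (Set.range B) := by
  induction hn : (-(w.1 + w.2)).toNat using Nat.strong_induction_on generalizing w with
  | _ n ih =>
  subst hn
  by_cases hw : 0 ≤ w.1 ∨ 0 ≤ w.2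
  · exact hout w hw
  obtain ⟨c, hc, hu, hge⟩ := exists_expansion hE (hB w) (hBE w)
  have hsum : c w • E w + ∑ u ∈ c.support.erase w, c u • E u = B w := by
    rw [← hc, Finsupp.linearCombination_apply, Finsupp.sum]
    exact Finset.add_sum_erase _ (fun u => c u • E u) (Finsupp.mem_support_iff.mpr hu.ne_zero)
  have hmem : c w • E w ∈ Submodule.span Coeff (Set.range B) := by
    rw [← eq_sub_iff_add_eq] at hsum
    rw [hsum]
    refine Submodule.sub_mem _ (Submodule.subset_span ⟨w, rfl⟩)
      (Submodule.sum_mem _ fun u hu => Submodule.smul_mem _ _ ?_)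
    obtain ⟨hne, hu⟩ := Finset.mem_erase.mp hu
    by_cases hu0 : 0 ≤ u.1 ∨ 0 ≤ u.2
    · exact hout u hu0
    refine ih _ ?_ u rfl
    have hle := hge u (Finsupp.mem_support_iff.mp hu)
    rw [Prod.le_def] at hle
    have : ¬ (u.1 = w.1 ∧ u.2 = w.2) := fun h => hne (Prod.ext h.1 h.2)
    omega
  exact (Submodule.smul_mem_iff_of_isUnit _ hu).mp hmem

/-! ### The acyclic monomials in `X₀, X₁, X₂, X₃` -/

theorem pow_mul_pow_of_skew {r : ℤ} {x y : QTorus} (h : x * y = qh r • (y * x)) (a b : ℕ) :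
    x ^ a * y ^ b = qh (a * b * r) • (y ^ b * x ^ a) := by
  have h1 (b : ℕ) : x * y ^ b = qh (b * r) • (y ^ b * x) := by
    induction b with
    | zero => simp [qh_zero]
    | succ b ih =>
      rw [pow_succ, ← mul_assoc, ih, smul_mul_assoc, mul_assoc, h, mul_smul_comm, smul_smul,
        ← qh_add, mul_assoc]
      congr 2
      push_cast
      ring
  induction a with
  | zero => simp [qh_zero]
  | succ a ih =>
    rw [pow_succ, mul_assoc, h1, mul_smul_comm, ← mul_assoc, ih, smul_mul_assoc, smul_smul,
      ← qh_add, mul_assoc (y ^ b)]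
    congr 2
    push_cast
    ring

theorem torusVar_zero : torusVar 0 = zeroVar := (torusVar_two_mul 0).trans evenVar_zero

theorem evenVar_two : evenVar 2 = fourVar := by
  have h := evenVar_fwd 1
  rw [Nat.cast_one, one_add_one_eq_two] at h
  rw [h, evenFwd, linSeq]

theorem torusVar_three : torusVar 3 = mono (-1) 0 + mono (-1) 4 := by
  have h : torusVar 3 = oddVar 1 := torusVar_two_mul_add_one 1
  rw [h, oddVar, evenVar_one, one_add_one_eq_two, evenVar_two, fourVar]
  simp only [mul_add, mono_mul_mono, one_eq_mono, smul_add, smul_sub, smul_smul, ← qh_add]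
  norm_num [qh_zero]
  abel

/-- No exchange relation covers the product of `X₀` and `X₃`. Comparing this formula with
`three_mul_zero` shows that `X₀` and `X₃` commute up to a power of `q` and a multiple of `X₂³`. -/
theorem zero_mul_three :
    torusVar 0 * torusVar 3 = qh (-1) • evenVar 2 + qh 3 • torusVar 2 ^ 3 := by
  rw [torusVar_zero, torusVar_three, torusVar_two, evenVar_two, zeroVar, fourVar, mono_pow]
  simp only [mul_add, add_mul, mono_mul_mono, smul_add]
  norm_num
  abel

theorem three_mul_zero :
    torusVar 3 * torusVar 0 = qh 1 • evenVar 2 + qh (-3) • torusVar 2 ^ 3 := by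
  rw [torusVar_zero, torusVar_three, torusVar_two, evenVar_two, zeroVar, fourVar, mono_pow]
  simp only [mul_add, add_mul, mono_mul_mono, smul_add]
  norm_num
  abel

theorem evenVar_two_eq :
    evenVar 2 = qh 1 • (torusVar 0 * torusVar 3) - qh 4 • torusVar 2 ^ 3 := by
  rw [zero_mul_three, smul_add, smul_smul, smul_smul, ← qh_add, ← qh_add]
  norm_num [qh_zero]

theorem three_mul_zero' : torusVar 3 * torusVar 0
    = qh 2 • (torusVar 0 * torusVar 3) + (qh (-3) - qh 5) • torusVar 2 ^ 3 := by
  rw [three_mul_zero, evenVar_two_eq, smul_sub, smul_smul, smul_smul, ← qh_add, ← qh_add,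
    sub_smul]
  norm_num
  abel

/-- The monomial in `X₀, X₁, X₂, X₃` with least exponent `w` that contains neither `X₀ X₂` nor
`X₁ X₃`. -/
def acyclicMono (w : ℤ × ℤ) : QTorus :=
  torusVar 0 ^ (-w.2).toNat * torusVar 1 ^ w.1.toNat * torusVar 2 ^ w.2.toNat *
    torusVar 3 ^ (-w.1).toNat

theorem pointed_acyclicMono (w : ℤ × ℤ) : Pointed w (acyclicMono w) := by
  have h0 : Pointed (0, -1) (torusVar 0) := by
    rw [torusVar_zero]
    exact pointed_zeroVar
  have h1 : Pointed (1, 0) (torusVar 1) := by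
    rw [torusVar_one]
    exact Pointed.mono 1 0
  have h2 : Pointed (0, 1) (torusVar 2) := by
    rw [torusVar_two]
    exact Pointed.mono 0 1
  have h3 : Pointed (-1, 0) (torusVar 3) := by
    have := pointed_torusVar 3
    simpa [lead, show ¬ Even (3 : ℤ) by decide] using this
  have h := (((h0.pow (-w.2).toNat).mul (h1.pow w.1.toNat)).mul (h2.pow w.2.toNat)).mul
    (h3.pow (-w.1).toNat)
  rw [acyclicMono]
  convert h using 1
  ext
  · simp
    omega
  · simp
    omega

/-- The span of the acyclic monomials. -/
def acyclicSpan : Submodule Coeff QTorus := Submodule.span Coeff (Set.range acyclicMono)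

theorem mem_acyclicSpan_zero_one (a b : ℕ) : torusVar 0 ^ a * torusVar 1 ^ b ∈ acyclicSpan :=
  Submodule.subset_span ⟨(b, -a), by simp [acyclicMono]⟩

theorem mem_acyclicSpan_one_two (b c : ℕ) : torusVar 1 ^ b * torusVar 2 ^ c ∈ acyclicSpan :=
  Submodule.subset_span ⟨(b, c), by simp [acyclicMono]⟩

theorem mem_acyclicSpan_two_three (c d : ℕ) : torusVar 2 ^ c * torusVar 3 ^ d ∈ acyclicSpan :=
  Submodule.subset_span ⟨(-d, c), by simp [acyclicMono]⟩

theorem mem_acyclicSpan_zero_three (a d : ℕ) : torusVar 0 ^ a * torusVar 3 ^ d ∈ acyclicSpan :=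
  Submodule.subset_span ⟨(-d, -a), by simp [acyclicMono]⟩

theorem acyclicMono_cases {p : QTorus → Prop}
    (h01 : ∀ a b : ℕ, p (torusVar 0 ^ a * torusVar 1 ^ b))
    (h12 : ∀ b c : ℕ, p (torusVar 1 ^ b * torusVar 2 ^ c))
    (h23 : ∀ c d : ℕ, p (torusVar 2 ^ c * torusVar 3 ^ d))
    (h03 : ∀ a d : ℕ, p (torusVar 0 ^ a * torusVar 3 ^ d)) (w : ℤ × ℤ) : p (acyclicMono w) := by
  obtain ⟨x, y⟩ := w
  rcases le_total 0 x with hx | hx <;> rcases le_total 0 y with hy | hy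
  · simpa [acyclicMono, Int.toNat_of_nonpos (neg_nonpos.mpr hx),
      Int.toNat_of_nonpos (neg_nonpos.mpr hy)] using h12 x.toNat y.toNat
  · simpa [acyclicMono, Int.toNat_of_nonpos (neg_nonpos.mpr hx),
      Int.toNat_of_nonpos hy] using h01 (-y).toNat x.toNat
  · simpa [acyclicMono, Int.toNat_of_nonpos hx,
      Int.toNat_of_nonpos (neg_nonpos.mpr hy)] using h23 y.toNat (-x).toNat
  · simpa [acyclicMono, Int.toNat_of_nonpos hx,
      Int.toNat_of_nonpos hy] using h03 (-y).toNat (-x).toNat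

/-- The elements `x` with `x * y ∈ acyclicSpan` for all `y ∈ acyclicSpan`. -/
def acyclicStabilizer : Subalgebra Coeff QTorus where
  carrier := {x | ∀ y ∈ acyclicSpan, x * y ∈ acyclicSpan}
  mul_mem' := fun hx hx' y hy => by
    rw [mul_assoc]
    exact hx _ (hx' y hy)
  add_mem' := fun hx hx' y hy => by
    rw [add_mul]
    exact Submodule.add_mem _ (hx y hy) (hx' y hy)
  algebraMap_mem' := fun c y hy => by
    rw [← Algebra.smul_def]
    exact Submodule.smul_mem _ c hy

theorem mem_acyclicStabilizer {x : QTorus} :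
    x ∈ acyclicStabilizer ↔ ∀ y ∈ acyclicSpan, x * y ∈ acyclicSpan := Iff.rfl

theorem mul_mem_acyclicSpan {x y : QTorus} (hx : x ∈ acyclicStabilizer) (hy : y ∈ acyclicSpan) :
    x * y ∈ acyclicSpan := mem_acyclicStabilizer.mp hx y hy

theorem mem_acyclicStabilizer_of_acyclicMono {x : QTorus}
    (h : ∀ w, x * acyclicMono w ∈ acyclicSpan) : x ∈ acyclicStabilizer := by
  rw [mem_acyclicStabilizer]
  intro y hy
  rw [acyclicSpan] at hy
  induction hy using Submodule.span_induction with
  | mem y hy =>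
    obtain ⟨w, rfl⟩ := hy
    exact h w
  | zero => simp only [mul_zero, Submodule.zero_mem]
  | add y z _ _ hy hz =>
    rw [mul_add]
    exact Submodule.add_mem _ hy hz
  | smul c y _ hy =>
    rw [mul_smul_comm]
    exact Submodule.smul_mem _ c hy

theorem mem_acyclicStabilizer_of_cases {x : QTorus}
    (h01 : ∀ a b : ℕ, x * (torusVar 0 ^ a * torusVar 1 ^ b) ∈ acyclicSpan)
    (h12 : ∀ b c : ℕ, x * (torusVar 1 ^ b * torusVar 2 ^ c) ∈ acyclicSpan)
    (h23 : ∀ c d : ℕ, x * (torusVar 2 ^ c * torusVar 3 ^ d) ∈ acyclicSpan)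
    (h03 : ∀ a d : ℕ, x * (torusVar 0 ^ a * torusVar 3 ^ d) ∈ acyclicSpan) :
    x ∈ acyclicStabilizer :=
  mem_acyclicStabilizer_of_acyclicMono
    (acyclicMono_cases (p := fun y => x * y ∈ acyclicSpan) h01 h12 h23 h03)

theorem torusVar_mul_pow (k : ℤ) (b : ℕ) : torusVar k * torusVar (k + 1) ^ b
    = qh (2 * b) • (torusVar (k + 1) ^ b * torusVar k) := by
  have h := pow_mul_pow_of_skew (torusVar_comm k) 1 b
  rw [pow_one] at h
  rw [h]
  congr 2
  push_cast
  ring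

theorem torusVar_succ_mul_pow (k : ℤ) (a : ℕ) : torusVar (k + 1) * torusVar k ^ a
    = qh (-(2 * a)) • (torusVar k ^ a * torusVar (k + 1)) := by
  have h := pow_mul_pow_of_skew (torusVar_comm k) a 1
  rw [pow_one] at h
  rw [h, smul_smul, ← qh_add, show -(2 * (a : ℤ)) + a * (1 : ℕ) * 2 = 0 by push_cast; ring,
    qh_zero, one_smul]

theorem zero_mul_two : torusVar 0 * torusVar 2 = qh 1 • torusVar 1 + 1 := by
  simpa using torusVar_mul_odd 0

theorem two_mul_zero : torusVar 2 * torusVar 0 = qh (-1) • torusVar 1 + 1 := by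
  have h0 := torusVar_two_mul 0
  have h1 := torusVar_two_mul_add_one 0
  have h2 := torusVar_two_mul 1
  have h := evenVar_mul_evenVar' 0
  norm_num at h0 h1 h2 h
  rw [h0, h1, h2, h]

theorem one_mul_three : torusVar 1 * torusVar 3 = qh 4 • torusVar 2 ^ 4 + 1 := by
  have h := torusVar_mul_even 1
  norm_num at h
  exact h

theorem three_mul_one : torusVar 3 * torusVar 1 = qh (-4) • torusVar 2 ^ 4 + 1 := by
  have h := congrArg bar one_mul_three
  rwa [bar_mul, map_add, bar_smul, bar_pow (bar_torusVar 2), bar_torusVar, bar_torusVar, bar_one,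
    invert_qh] at h

/-- Left multiplication by `X₀` preserves the span of the acyclic monomials: `X₀` is moved to the
right until it meets `X₂`, and `X₀ X₂` is replaced with the help of the exchange relation. The
corresponding statements for `X₁`, `X₂` and `X₃` each build on the preceding ones. -/
theorem torusVar_zero_mem : torusVar 0 ∈ acyclicStabilizer := by
  have h12 (b c : ℕ) : torusVar 0 * (torusVar 1 ^ b * torusVar 2 ^ c) ∈ acyclicSpan := by
    cases c with
    | zero => simpa using mem_acyclicSpan_zero_one 1 b
    | succ c =>
      have h := torusVar_mul_pow 0 b
      rw [zero_add] at h
      have e : torusVar 0 * (torusVar 1 ^ b * torusVar 2 ^ (c + 1)) = qh (2 * b) •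
          (qh 1 • (torusVar 1 ^ (b + 1) * torusVar 2 ^ c) + torusVar 1 ^ b * torusVar 2 ^ c) := by
        rw [← mul_assoc, h, pow_succ' _ c, smul_mul_assoc, mul_assoc (torusVar 1 ^ b),
          ← mul_assoc (torusVar 0), zero_mul_two, add_mul, one_mul, mul_add, smul_mul_assoc,
          mul_smul_comm, pow_succ _ b, mul_assoc (torusVar 1 ^ b)]
      rw [e]
      exact Submodule.smul_mem _ _ (Submodule.add_mem _
        (Submodule.smul_mem _ _ (mem_acyclicSpan_one_two _ _)) (mem_acyclicSpan_one_two _ _))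
  refine mem_acyclicStabilizer_of_cases (fun a b => ?_) h12
    (fun c d => ?_) (fun a d => ?_)
  · rw [← mul_assoc, ← pow_succ']
    exact mem_acyclicSpan_zero_one _ _
  · cases c with
    | zero => simpa using mem_acyclicSpan_zero_three 1 d
    | succ c =>
      cases d with
      | zero => simpa using h12 0 (c + 1)
      | succ d =>
        have h := torusVar_mul_pow 1 c
        rw [one_add_one_eq_two] at h
        have e : torusVar 0 * (torusVar 2 ^ (c + 1) * torusVar 3 ^ (d + 1)) =
            qh 1 • qh (2 * c) • (qh 4 • (torusVar 2 ^ (c + 4) * torusVar 3 ^ d)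
              + torusVar 2 ^ c * torusVar 3 ^ d) + torusVar 2 ^ c * torusVar 3 ^ (d + 1) := by
          rw [pow_succ' _ c, ← mul_assoc, ← mul_assoc, zero_mul_two, add_mul, add_mul, one_mul,
            smul_mul_assoc, smul_mul_assoc, h, smul_mul_assoc, pow_succ' _ d,
            mul_assoc (torusVar 2 ^ c), ← mul_assoc (torusVar 1), one_mul_three, add_mul,
            smul_mul_assoc, mul_add, mul_smul_comm, one_mul, ← mul_assoc, ← pow_add]
        rw [e]
        exact Submodule.add_mem _ (Submodule.smul_mem _ _ (Submodule.smul_mem _ _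
          (Submodule.add_mem _ (Submodule.smul_mem _ _ (mem_acyclicSpan_two_three _ _))
          (mem_acyclicSpan_two_three _ _)))) (mem_acyclicSpan_two_three _ _)
  · rw [← mul_assoc, ← pow_succ']
    exact mem_acyclicSpan_zero_three _ _

theorem torusVar_one_mem : torusVar 1 ∈ acyclicStabilizer := by
  refine mem_acyclicStabilizer_of_cases (fun a b => ?_) (fun b c => ?_)
    (fun c d => ?_) (fun a d => ?_)
  · have h := torusVar_succ_mul_pow 0 a
    rw [zero_add] at h
    rw [← mul_assoc, h, smul_mul_assoc, mul_assoc, ← pow_succ']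
    exact Submodule.smul_mem _ _ (mem_acyclicSpan_zero_one _ _)
  · rw [← mul_assoc, ← pow_succ']
    exact mem_acyclicSpan_one_two _ _
  · cases d with
    | zero => simpa using mem_acyclicSpan_one_two 1 c
    | succ d =>
      have h := torusVar_mul_pow 1 c
      rw [one_add_one_eq_two] at h
      rw [← mul_assoc, h, smul_mul_assoc, pow_succ' _ d, mul_assoc (torusVar 2 ^ c),
        ← mul_assoc (torusVar 1), one_mul_three, add_mul,
        smul_mul_assoc, mul_add, mul_smul_comm, one_mul, ← mul_assoc, ← pow_add]
      exact Submodule.smul_mem _ _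
          (Submodule.add_mem _ (Submodule.smul_mem _ _ (mem_acyclicSpan_two_three _ _))
          (mem_acyclicSpan_two_three _ _))
  · have h := torusVar_succ_mul_pow 0 a
    rw [zero_add] at h
    rw [← mul_assoc, h, smul_mul_assoc, mul_assoc]
    refine Submodule.smul_mem _ _ (mul_mem_acyclicSpan (pow_mem torusVar_zero_mem a) ?_)
    cases d with
    | zero => simpa using mem_acyclicSpan_one_two 1 0
    | succ d =>
      rw [pow_succ', ← mul_assoc, one_mul_three, add_mul, smul_mul_assoc, one_mul]
      refine Submodule.add_mem _ (Submodule.smul_mem _ _ (mem_acyclicSpan_two_three _ _)) ?_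
      simpa using mem_acyclicSpan_two_three 0 d

theorem torusVar_two_mem : torusVar 2 ∈ acyclicStabilizer := by
  have h0 (a : ℕ) (y : QTorus) (hy : y ∈ acyclicSpan) (hy' : torusVar 2 * y ∈ acyclicSpan) :
      torusVar 2 * (torusVar 0 ^ a * y) ∈ acyclicSpan := by
    cases a with
    | zero => simpa using hy'
    | succ a =>
      have := mul_mem_acyclicSpan (pow_mem torusVar_zero_mem a) hy
      rw [pow_succ', mul_assoc, ← mul_assoc, two_mul_zero, add_mul, one_mul, smul_mul_assoc]
      exact Submodule.add_mem _
        (Submodule.smul_mem _ _ (mul_mem_acyclicSpan torusVar_one_mem this)) this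
  have h12 (b c : ℕ) : torusVar 2 * (torusVar 1 ^ b * torusVar 2 ^ c) ∈ acyclicSpan := by
    have h := torusVar_succ_mul_pow 1 b
    rw [one_add_one_eq_two] at h
    rw [← mul_assoc, h, smul_mul_assoc, mul_assoc, ← pow_succ']
    exact Submodule.smul_mem _ _ (mem_acyclicSpan_one_two _ _)
  have h23 (c d : ℕ) : torusVar 2 * (torusVar 2 ^ c * torusVar 3 ^ d) ∈ acyclicSpan := by
    rw [← mul_assoc, ← pow_succ']
    exact mem_acyclicSpan_two_three _ _
  refine mem_acyclicStabilizer_of_cases (fun a b => ?_) h12 h23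
    (fun a d => ?_)
  · exact h0 a _ (by simpa using mem_acyclicSpan_one_two b 0) (by simpa using h12 b 0)
  · exact h0 a _ (by simpa using mem_acyclicSpan_two_three 0 d) (by simpa using h23 0 d)

theorem torusVar_three_mem : torusVar 3 ∈ acyclicStabilizer := by
  have h0 (y : QTorus) (hy : y ∈ acyclicSpan) (hy' : torusVar 3 * y ∈ acyclicSpan) (a : ℕ) :
      torusVar 3 * (torusVar 0 ^ a * y) ∈ acyclicSpan := by
    induction a with
    | zero => simpa using hy'
    | succ a ih =>
      have := mul_mem_acyclicSpan (pow_mem torusVar_zero_mem a) hy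
      rw [pow_succ', mul_assoc, ← mul_assoc, three_mul_zero', add_mul, smul_mul_assoc,
        smul_mul_assoc, mul_assoc]
      exact Submodule.add_mem _ (Submodule.smul_mem _ _ (mul_mem_acyclicSpan torusVar_zero_mem ih))
        (Submodule.smul_mem _ _ (mul_mem_acyclicSpan (pow_mem torusVar_two_mem 3) this))
  have h23 (c d : ℕ) : torusVar 3 * (torusVar 2 ^ c * torusVar 3 ^ d) ∈ acyclicSpan := by
    have h := torusVar_succ_mul_pow 2 c
    rw [show (2 : ℤ) + 1 = 3 by norm_num] at h
    rw [← mul_assoc, h, smul_mul_assoc, mul_assoc, ← pow_succ']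
    exact Submodule.smul_mem _ _ (mem_acyclicSpan_two_three _ _)
  have h12 (b c : ℕ) : torusVar 3 * (torusVar 1 ^ b * torusVar 2 ^ c) ∈ acyclicSpan := by
    cases b with
    | zero => simpa using h23 c 0
    | succ b =>
      have := mem_acyclicSpan_one_two b c
      rw [pow_succ', mul_assoc, ← mul_assoc, three_mul_one, add_mul, one_mul, smul_mul_assoc]
      exact Submodule.add_mem _
        (Submodule.smul_mem _ _ (mul_mem_acyclicSpan (pow_mem torusVar_two_mem 4) this)) this
  refine mem_acyclicStabilizer_of_cases (fun a b => ?_) h12 h23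
    (fun a d => ?_)
  · exact h0 _ (by simpa using mem_acyclicSpan_one_two b 0) (by simpa using h12 b 0) a
  · exact h0 _ (by simpa using mem_acyclicSpan_two_three 0 d) (by simpa using h23 0 d) a

/-! ### The cluster algebra inside the quantum torus -/

theorem deltaT_mem {S : Subalgebra Coeff QTorus} (h0 : torusVar 0 ∈ S) (h2 : torusVar 2 ∈ S)
    (h4 : evenVar 2 ∈ S) : deltaT ∈ S := by
  have h := (exchangeTriple_evenVar 1).mul_skip
  rw [sub_self, one_add_one_eq_two, ← torusVar_two_mul 0, ← torusVar_two_mul 1, mul_zero,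
    mul_one] at h
  have e : deltaT = qh 1 • (torusVar 0 * evenVar 2 - qh 1 ^ 2 • torusVar 2 ^ 2) := by
    rw [h, add_sub_cancel_left, smul_smul, qh_mul_neg, one_smul]
  rw [e]
  exact S.smul_mem (S.sub_mem (S.mul_mem h0 h4) (S.smul_mem (pow_mem h2 2) _)) _

/-- A subalgebra that contains `X₀, X₁, X₂, X₃` contains every cluster variable. -/
theorem torusVar_mem {S : Subalgebra Coeff QTorus} (h0 : torusVar 0 ∈ S) (h2 : torusVar 2 ∈ S)
    (h3 : torusVar 3 ∈ S) (k : ℤ) : torusVar k ∈ S := by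
  have h4 : evenVar 2 ∈ S := by
    rw [evenVar_two_eq]
    exact S.sub_mem (S.smul_mem (S.mul_mem h0 h3) _) (S.smul_mem (pow_mem h2 3) _)
  have hZ := deltaT_mem h0 h2 h4
  have key (m : ℤ) (h0 : evenVar (m - 1) ∈ S) (h1 : evenVar m ∈ S) : evenVar (m + 1) ∈ S := by
    rw [(exchangeTriple_evenVar m).right_eq (qh_mul_neg 1)]
    exact S.sub_mem (S.smul_mem (S.mul_mem h1 hZ) _) (S.smul_mem h0 _)
  have key' (m : ℤ) (h0 : evenVar (m + 1) ∈ S) (h1 : evenVar m ∈ S) : evenVar (m - 1) ∈ S := by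
    rw [((exchangeTriple_evenVar m).swap (qh_mul_neg 1)).right_eq (qh_neg_mul 1)]
    exact S.sub_mem (S.smul_mem (S.mul_mem h1 hZ) _) (S.smul_mem h0 _)
  have heven (m : ℤ) : evenVar m ∈ S ∧ evenVar (m + 1) ∈ S := by
    induction m with
    | zero => exact ⟨by rw [← torusVar_two_mul]; exact h0,
        by rw [← torusVar_two_mul]; exact h2⟩
    | succ n ih => exact ⟨ih.2, key _ (by simpa using ih.1) ih.2⟩
    | pred n ih => exact ⟨key' _ ih.2 ih.1, by simpa using ih.1⟩
  rw [torusVar]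
  split_ifs
  · exact (heven _).1
  · exact S.smul_mem (S.sub_mem (S.mul_mem (heven _).1 (heven _).2) S.one_mem) _

/-- The subalgebra of the quantum torus generated by the cluster variables. -/
def torusClusterAlg : Subalgebra Coeff QTorus := Algebra.adjoin Coeff (Set.range torusVar)

theorem torusVar_mem_torusClusterAlg (k : ℤ) : torusVar k ∈ torusClusterAlg :=
  Algebra.subset_adjoin ⟨k, rfl⟩

theorem deltaT_mem_torusClusterAlg : deltaT ∈ torusClusterAlg :=
  deltaT_mem (torusVar_mem_torusClusterAlg 0) (torusVar_mem_torusClusterAlg 2)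
    (by rw [← torusVar_two_mul]; exact torusVar_mem_torusClusterAlg _)

/-- The acyclic monomials span the cluster algebra. -/
theorem toSubmodule_torusClusterAlg :
    Subalgebra.toSubmodule torusClusterAlg = acyclicSpan := by
  apply le_antisymm
  · intro x hx
    have hle : torusClusterAlg ≤ acyclicStabilizer := Algebra.adjoin_le (by
      rintro _ ⟨k, rfl⟩
      exact torusVar_mem torusVar_zero_mem torusVar_two_mem torusVar_three_mem k)
    have := mul_mem_acyclicSpan (y := 1) (hle hx) (by simpa using mem_acyclicSpan_zero_one 0 0)
    rwa [mul_one] at this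
  · refine Submodule.span_le.mpr ?_
    rintro _ ⟨w, rfl⟩
    have h := torusVar_mem_torusClusterAlg
    rw [SetLike.mem_coe, Subalgebra.mem_toSubmodule, acyclicMono]
    exact mul_mem (mul_mem (mul_mem (pow_mem (h 0) _) (pow_mem (h 1) _)) (pow_mem (h 2) _))
      (pow_mem (h 3) _)

/-! ### The three families of pointed elements -/

/-- The cluster monomial `q^{-ab/2} X_m^a X_{m+1}^b` in the quantum torus. -/
def clusterMono (m : ℤ) (a b : ℕ) : QTorus :=
  qh (-(a * b)) • (torusVar m ^ a * torusVar (m + 1) ^ b)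

theorem bar_clusterMono (m : ℤ) (a b : ℕ) : bar (clusterMono m a b) = clusterMono m a b := by
  rw [clusterMono, bar_smul, bar_mul, bar_pow (bar_torusVar _), bar_pow (bar_torusVar _),
    invert_qh, pow_mul_pow_of_skew (torusVar_comm m) a b, smul_smul, ← qh_add]
  congr 2
  ring

theorem pointed_clusterMono (m : ℤ) (a b : ℕ) : Pointed (leadMono m a b) (clusterMono m a b) :=
  (((pointed_torusVar m).pow a).mul ((pointed_torusVar (m + 1)).pow b)).smul (isUnit_qh _)

theorem smul_clusterMono (m : ℤ) (a b : ℕ) :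
    qh (a * b) • clusterMono m a b = torusVar m ^ a * torusVar (m + 1) ^ b := by
  rw [clusterMono, smul_smul, qh_mul_neg, one_smul]

theorem clusterMono_mem (m : ℤ) (a b : ℕ) : clusterMono m a b ∈ torusClusterAlg :=
  torusClusterAlg.smul_mem (mul_mem (pow_mem (torusVar_mem_torusClusterAlg _) _)
    (pow_mem (torusVar_mem_torusClusterAlg _) _)) _

theorem bar_aeval_deltaT (p : Polynomial ℤ) :
    bar (Polynomial.aeval deltaT p) = Polynomial.aeval deltaT p := by
  simp only [Polynomial.aeval_eq_sum_range, map_sum, map_zsmul, bar_pow bar_deltaT]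

theorem pointed_aeval_deltaT {p : Polynomial ℤ} (hp : p.Monic) :
    Pointed (-(p.natDegree : ℤ), -2 * (p.natDegree : ℤ)) (Polynomial.aeval deltaT p) := by
  have hpow (n : ℕ) : Pointed (-(n : ℤ), -2 * (n : ℤ)) (deltaT ^ n) := by
    convert pointed_deltaT.pow n using 1
    ext
    · simp
    · simp [mul_comm]
  rw [Polynomial.aeval_eq_sum_range, Finset.sum_range_succ, add_comm, hp.coeff_natDegree, one_smul]
  refine (hpow _).add_of_lt ?_
  refine Finset.sum_induction _
    (fun y : QTorus => ∀ u, y.coeff u ≠ 0 → (-(p.natDegree : ℤ), -2 * (p.natDegree : ℤ)) < u)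
    (fun x y hx hy u hu => ?_) (fun u hu => absurd rfl hu) (fun i hi => ?_)
  · by_cases h : x.coeff u = 0
    · refine hy u fun h' => hu ?_
      rw [coeff_add, Finsupp.add_apply, h, h', add_zero]
    · exact hx u h
  · rw [Finset.mem_range] at hi
    rw [← Int.cast_smul_eq_zsmul Coeff]
    exact (hpow i).lt_of_smul (lt_of_coords (by omega)) _

theorem aeval_deltaT_mem (p : Polynomial ℤ) : Polynomial.aeval deltaT p ∈ torusClusterAlg := by
  rw [Polynomial.aeval_eq_sum_range]
  exact sum_mem fun i _ => zsmul_mem (pow_mem deltaT_mem_torusClusterAlg i) _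

/-- The cluster monomials, indexed by `(m, a, b)`, together with the elements `p_n(X_δ)`. -/
def element (p : ℕ → Polynomial ℤ) : (ℤ × ℕ × ℕ) ⊕ ℕ → QTorus :=
  Sum.elim (fun i => clusterMono i.1 i.2.1 i.2.2) (fun n => Polynomial.aeval deltaT (p n))

/-- The least exponent of `element p i`, if `p n` is monic of degree `n`. -/
def elementLead : (ℤ × ℕ × ℕ) ⊕ ℕ → ℤ × ℤ :=
  Sum.elim (fun i => leadMono i.1 i.2.1 i.2.2) (fun n => (-(n : ℤ), -2 * (n : ℤ)))

theorem bar_element (p : ℕ → Polynomial ℤ) (i) : bar (element p i) = element p i := by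
  rcases i with i | n
  exacts [bar_clusterMono _ _ _, bar_aeval_deltaT _]

theorem element_mem (p : ℕ → Polynomial ℤ) (i) : element p i ∈ torusClusterAlg := by
  rcases i with i | n
  exacts [clusterMono_mem _ _ _, aeval_deltaT_mem _]

theorem pointed_element {p : ℕ → Polynomial ℤ} (hp : ∀ n, (p n).Monic ∧ (p n).natDegree = n) (i) :
    Pointed (elementLead i) (element p i) := by
  rcases i with i | n
  · exact pointed_clusterMono _ _ _
  · have h := pointed_aeval_deltaT (hp n).1
    rw [(hp n).2] at h
    exact h

theorem elementLead_surjective : Function.Surjective elementLead := by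
  intro v
  rcases exists_leadMono v with ⟨m, a, b, h⟩ | ⟨n, h⟩
  exacts [⟨Sum.inl (m, a, b), h⟩, ⟨Sum.inr n, h.symm⟩]

/-- Every index can be replaced with one in normal form: a cluster monomial with `0 < a` or an
element `p_n(X_δ)`, the element `1` being `p_0(X_δ)`. -/
theorem element_normal {p : ℕ → Polynomial ℤ} (hp : ∀ n, (p n).Monic ∧ (p n).natDegree = n) (i) :
    (∃ m a b, 0 < a ∧ element p i = clusterMono m a b ∧ elementLead i = leadMono m a b) ∨
      ∃ n : ℕ, element p i = Polynomial.aeval deltaT (p n) ∧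
        elementLead i = (-(n : ℤ), -2 * (n : ℤ)) := by
  rcases i with ⟨m, a, b⟩ | n
  · change (∃ m' a' b', 0 < a' ∧ clusterMono m a b = clusterMono m' a' b' ∧
      leadMono m a b = leadMono m' a' b') ∨ ∃ n : ℕ, clusterMono m a b =
        Polynomial.aeval deltaT (p n) ∧ leadMono m a b = (-(n : ℤ), -2 * (n : ℤ))
    rcases Nat.eq_zero_or_pos a with rfl | ha
    · rcases Nat.eq_zero_or_pos b with rfl | hb
      · right
        refine ⟨0, ?_, ?_⟩
        · rw [(hp 0).1.natDegree_eq_zero.mp (hp 0).2]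
          simp [clusterMono, qh_zero]
        · ext <;> simp [leadMono]
      · left
        refine ⟨m + 1, b, 0, hb, ?_, ?_⟩
        · simp [clusterMono]
        · simp [leadMono]
    · exact Or.inl ⟨m, a, b, ha, rfl, rfl⟩
  · exact Or.inr ⟨n, rfl, rfl⟩

theorem element_eq_of_lead_eq {p : ℕ → Polynomial ℤ}
    (hp : ∀ n, (p n).Monic ∧ (p n).natDegree = n) {i j} (h : elementLead i = elementLead j) :
    element p i = element p j := by
  rcases element_normal hp i with ⟨m, a, b, ha, e, l⟩ | ⟨n, e, l⟩ <;>
    rcases element_normal hp j with ⟨m', a', b', ha', e', l'⟩ | ⟨n', e', l'⟩ <;>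
    rw [l, l'] at h <;> rw [e, e']
  · obtain ⟨rfl, rfl, rfl⟩ := leadMono_injective ha ha' h
    rfl
  · exact absurd h (leadMono_ne_delta _ ha _ _)
  · exact absurd h.symm (leadMono_ne_delta _ ha' _ _)
  · have h1 := congrArg Prod.fst h
    dsimp only at h1
    obtain rfl : n = n' := by omega
    rfl

/-- The elements `element p i`, indexed by their least exponents. -/
def pointedFamily (p : ℕ → Polynomial ℤ) (v : ℤ × ℤ) : QTorus :=
  element p (Function.surjInv elementLead_surjective v)

theorem pointed_pointedFamily {p : ℕ → Polynomial ℤ}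
    (hp : ∀ n, (p n).Monic ∧ (p n).natDegree = n) (v : ℤ × ℤ) : Pointed v (pointedFamily p v) := by
  have h := pointed_element hp (Function.surjInv elementLead_surjective v)
  rwa [Function.surjInv_eq elementLead_surjective] at h

theorem pointedFamily_elementLead {p : ℕ → Polynomial ℤ}
    (hp : ∀ n, (p n).Monic ∧ (p n).natDegree = n) (i) :
    pointedFamily p (elementLead i) = element p i :=
  element_eq_of_lead_eq hp (Function.surjInv_eq _ _)

theorem span_pointedFamily {p : ℕ → Polynomial ℤ}
    (hp : ∀ n, (p n).Monic ∧ (p n).natDegree = n) :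
    Submodule.span Coeff (Set.range (pointedFamily p)) =
      Subalgebra.toSubmodule torusClusterAlg := by
  have hmem (v : ℤ × ℤ) : pointedFamily p v ∈ acyclicSpan := by
    rw [← toSubmodule_torusClusterAlg]
    exact element_mem p _
  have hcl (m : ℤ) (a b : ℕ) : torusVar m ^ a * torusVar (m + 1) ^ b ∈
      Submodule.span Coeff (Set.range (pointedFamily p)) := by
    rw [← smul_clusterMono]
    exact Submodule.smul_mem _ _ (Submodule.subset_span
      ⟨_, pointedFamily_elementLead hp (Sum.inl (m, a, b))⟩)
  rw [toSubmodule_torusClusterAlg]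
  apply le_antisymm
  · refine Submodule.span_le.mpr ?_
    rintro _ ⟨v, rfl⟩
    exact hmem v
  · refine Submodule.span_le.mpr ?_
    rintro _ ⟨w, rfl⟩
    refine mem_span_of_pointed pointed_acyclicMono (pointed_pointedFamily hp) hmem ?_ w
    rintro ⟨x, y⟩ h
    dsimp only at h
    -- In the other quadrants only two adjacent variables occur in the acyclic monomial.
    rcases le_total 0 x with hx | hx <;> rcases le_total 0 y with hy | hy
    · simpa [acyclicMono, Int.toNat_of_nonpos (neg_nonpos.mpr hx),
        Int.toNat_of_nonpos (neg_nonpos.mpr hy)] using hcl 1 x.toNat y.toNat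
    · simpa [acyclicMono, Int.toNat_of_nonpos (neg_nonpos.mpr hx),
        Int.toNat_of_nonpos hy] using hcl 0 (-y).toNat x.toNat
    · simpa [acyclicMono, Int.toNat_of_nonpos hx,
        Int.toNat_of_nonpos (neg_nonpos.mpr hy)] using hcl 2 y.toNat (-x).toNat
    · rcases h with h | h
      · obtain rfl : x = 0 := le_antisymm hx h
        simpa [acyclicMono, Int.toNat_of_nonpos hy] using hcl 0 (-y).toNat 0
      · obtain rfl : y = 0 := le_antisymm hy h
        simpa [acyclicMono, Int.toNat_of_nonpos hx] using hcl 2 0 (-x).toNat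

/-! ### Passage to the skew field of fractions -/

/-- The inclusion of the quantum torus in its skew field of fractions, as an algebra map. -/
def inclAlg : QTorus →ₐ[Coeff] SkewFrac :=
  AlgHom.ofLinearMap ⟨incl.toAddMonoidHom, fun r x => (OreLocalization.smul_oreDiv_one r x).symm⟩
    (map_one incl) (map_mul incl)

theorem inclAlg_apply (x : QTorus) : inclAlg x = incl x := rfl

theorem inclAlg_injective : Function.Injective inclAlg :=
  OreLocalization.numeratorHom_inj inf_le_left

theorem inclAlg_torusVar_ne_zero (k : ℤ) : inclAlg (torusVar k) ≠ 0 := fun h =>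
  torusVar_ne_zero k (inclAlg_injective (h.trans (map_zero inclAlg).symm))

theorem exch_inclAlg (k : ℤ) : exch k (inclAlg (torusVar k)) =
    inclAlg (torusVar (k - 1)) * inclAlg (torusVar (k + 1)) := by
  obtain ⟨m, rfl | rfl⟩ := Int.even_or_odd' k
  · rw [exch, if_neg (by simp), ← map_mul, torusVar_mul_even, map_add, map_smul, map_pow, map_one]
  · rw [exch, if_pos (by simp), ← map_mul, add_sub_cancel_right,
      show 2 * m + 1 + 1 = 2 * m + 2 by ring, torusVar_mul_odd, map_add, map_smul, map_one]

theorem forward_eq (n : ℕ) :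
    forward n = (inclAlg (torusVar (n + 1)), inclAlg (torusVar (n + 2))) := by
  induction n with
  | zero => simp [forward, torusVar_one, torusVar_two, inclAlg_apply]
  | succ n ih =>
    rw [forward, ih]
    dsimp only
    rw [exch_inclAlg, show (n : ℤ) + 2 - 1 = n + 1 by ring,
      inv_mul_cancel_left₀ (inclAlg_torusVar_ne_zero _),
      show ((n + 1 : ℕ) : ℤ) + 1 = n + 2 by push_cast; ring,
      show ((n + 1 : ℕ) : ℤ) + 2 = n + 2 + 1 by push_cast; ring]

theorem backward_eq (n : ℕ) :
    backward n = (inclAlg (torusVar (1 - n)), inclAlg (torusVar (2 - n))) := by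
  induction n with
  | zero => simp [backward, torusVar_one, torusVar_two, inclAlg_apply]
  | succ n ih =>
    rw [backward, ih]
    dsimp only
    rw [exch_inclAlg, show 1 - (n : ℤ) + 1 = 2 - n by ring,
      mul_inv_cancel_right₀ (inclAlg_torusVar_ne_zero _),
      show 1 - ((n + 1 : ℕ) : ℤ) = 1 - n - 1 by push_cast; ring,
      show 2 - ((n + 1 : ℕ) : ℤ) = 1 - n by push_cast; ring]

theorem clusterVar_eq (k : ℤ) : clusterVar k = inclAlg (torusVar k) := by
  rcases k with (_ | n) | n
  · change (backward 1).1 = _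
    rw [backward_eq]
    norm_num
  · change (forward n).1 = _
    rw [forward_eq, Int.ofNat_eq_natCast, Nat.cast_succ]
  · change (backward (n + 2)).1 = _
    rw [backward_eq, Int.negSucc_eq,
      show -((n : ℤ) + 1) = 1 - (n + 2 : ℕ) by push_cast; ring]

theorem Xdelta_eq : Xdelta = inclAlg deltaT := rfl

theorem toSubmodule_clusterAlg : Subalgebra.toSubmodule clusterAlg =
    (Subalgebra.toSubmodule torusClusterAlg).map inclAlg.toLinearMap := by
  have h : Set.range clusterVar = inclAlg '' Set.range torusVar := by
    rw [← Set.range_comp]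
    exact congrArg Set.range (funext clusterVar_eq)
  rw [clusterAlg, h, Algebra.adjoin_image]
  rfl

theorem isBarInvariantBasis_of_monic {p : ℕ → Polynomial ℤ}
    (hp : ∀ n, (p n).Monic ∧ (p n).natDegree = n) :
    IsBarInvariantBasis
      (clusterMonomials ∪ {x | ∃ n : ℕ, x = Polynomial.aeval Xdelta (p n)}) := by
  have hcl (m : ℤ) (a b : ℕ) :
      qh (-(a * b)) • (clusterVar m ^ a * clusterVar (m + 1) ^ b) =
        inclAlg (clusterMono m a b) := by
    rw [clusterVar_eq, clusterVar_eq, clusterMono, map_smul, map_mul, map_pow, map_pow]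
  have hδ (n : ℕ) : Polynomial.aeval Xdelta (p n) =
      inclAlg (Polynomial.aeval deltaT (p n)) := by
    rw [Xdelta_eq]
    exact Polynomial.aeval_algHom_apply (inclAlg.restrictScalars ℤ) deltaT (p n)
  have hset : clusterMonomials ∪ {x | ∃ n : ℕ, x = Polynomial.aeval Xdelta (p n)} =
      Set.range (inclAlg ∘ pointedFamily p) := by
    apply Set.Subset.antisymm
    · rintro _ (⟨m, a, b, rfl⟩ | ⟨n, rfl⟩)
      · exact ⟨_, (congrArg inclAlg
          (pointedFamily_elementLead hp (Sum.inl (m, a, b)))).trans (hcl m a b).symm⟩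
      · exact ⟨_, (congrArg inclAlg
          (pointedFamily_elementLead hp (Sum.inr n))).trans (hδ n).symm⟩
    · rintro _ ⟨v, rfl⟩
      rw [Function.comp_apply, pointedFamily]
      rcases Function.surjInv elementLead_surjective v with ⟨m, a, b⟩ | n
      · exact Or.inl ⟨m, a, b, (hcl m a b).symm⟩
      · exact Or.inr ⟨n, (hδ n).symm⟩
  rw [hset]
  refine ⟨?_, ?_, ?_⟩
  · rintro _ ⟨v, rfl⟩
    exact ⟨_, rfl, bar_element p _⟩
  · exact ((linearIndependent_of_pointed (pointed_pointedFamily hp)).map' inclAlg.toLinearMap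
      (LinearMap.ker_eq_bot.mpr inclAlg_injective)).linearIndepOn_id
  · rw [toSubmodule_clusterAlg, ← span_pointedFamily hp, Submodule.map_span, Set.range_comp]
    rfl

/-! ### The Chebyshev polynomials -/

theorem monic_sub_of_recursion {f : ℕ → Polynomial ℤ}
    (h1 : (f 1).Monic ∧ (f 1).natDegree = 1) (h2 : (f 2).Monic ∧ (f 2).natDegree = 2)
    (h : ∀ n, f (n + 3) = f (n + 2) * Polynomial.X - f (n + 1)) (n : ℕ) :
    (f (n + 1)).Monic ∧ (f (n + 1)).natDegree = n + 1 := by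
  suffices hs : ((f (n + 1)).Monic ∧ (f (n + 1)).natDegree = n + 1) ∧
      (f (n + 2)).Monic ∧ (f (n + 2)).natDegree = n + 2 from hs.1
  induction n with
  | zero => exact ⟨h1, h2⟩
  | succ n ih =>
    obtain ⟨⟨m1, d1⟩, m2, d2⟩ := ih
    refine ⟨⟨m2, d2⟩, ?_⟩
    have hm : (f (n + 2) * Polynomial.X).Monic := m2.mul Polynomial.monic_X
    have hd : (f (n + 2) * Polynomial.X).natDegree = n + 3 := by
      rw [m2.natDegree_mul Polynomial.monic_X, d2, Polynomial.natDegree_X]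
    have hlt : (f (n + 1)).natDegree < (f (n + 2) * Polynomial.X).natDegree := by omega
    rw [h]
    exact ⟨hm.sub_of_left (Polynomial.degree_lt_degree hlt),
      (Polynomial.natDegree_sub_eq_left_of_natDegree_lt hlt).trans hd⟩

theorem monic_chebF (n : ℕ) : (chebF n).Monic ∧ (chebF n).natDegree = n := by
  cases n with
  | zero => exact ⟨Polynomial.monic_one, Polynomial.natDegree_one⟩
  | succ n =>
    refine monic_sub_of_recursion ⟨Polynomial.monic_X, Polynomial.natDegree_X⟩ ?_
      (fun n => rfl) n
    rw [chebF, ← Polynomial.C_ofNat]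
    exact ⟨Polynomial.monic_X_pow_sub_C 2 two_ne_zero, Polynomial.natDegree_X_pow_sub_C⟩

theorem monic_chebS (n : ℕ) : (chebS n).Monic ∧ (chebS n).natDegree = n := by
  cases n with
  | zero => exact ⟨Polynomial.monic_one, Polynomial.natDegree_one⟩
  | succ n =>
    refine monic_sub_of_recursion ⟨Polynomial.monic_X, Polynomial.natDegree_X⟩ ?_
      (fun n => rfl) n
    rw [chebS, ← Polynomial.C_1]
    exact ⟨Polynomial.monic_X_pow_sub_C 1 two_ne_zero, Polynomial.natDegree_X_pow_sub_C⟩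

end QCluster

end

theorem mainTheorem2 :
    QCluster.IsBarInvariantBasis QCluster.setB ∧
      QCluster.IsBarInvariantBasis QCluster.setS ∧
      QCluster.IsBarInvariantBasis QCluster.setD := by
  refine ⟨QCluster.isBarInvariantBasis_of_monic QCluster.monic_chebF,
    QCluster.isBarInvariantBasis_of_monic QCluster.monic_chebS, ?_⟩
  have h := QCluster.isBarInvariantBasis_of_monic (p := fun n => Polynomial.X ^ n)
    fun n => ⟨Polynomial.monic_X_pow n, Polynomial.natDegree_X_pow n⟩
  rw [QCluster.setD]
  simpa only [map_pow, Polynomial.aeval_X] using h
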